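/- **Setting.** Let $a>b>0$, $p=\sqrt{a^2+b^2}$, $r=\sqrt{a^2-b^2}$. On $e(3,2)^*=\{(\mathbf g,\boldsymbol\alpha,\boldsymbol\beta)\}\cong\mathbb R^9$ with the Lie–Poisson bracket $\{g_i,g_j\}=-\varepsilon_{ijk}g_k$, $\{g_i,\alpha_j\}=-\varepsilon_{ijk}\alpha_k$, $\{g_i,\beta_j\}=-\varepsilon_{ijk}\beta_k$, $\{\alpha_i,\alpha_j\}=\{\beta_i,\beta_j\}=\{\alpha_i,\beta_j\}=0$, put $\mathbf g=(2\omega_1,2\omega_2,\omega_3)$ and consider the Euler equations $\dot x=\{x,H\}$ with $$H=\omega_1^2+\omega_2^2+\tfrac12\omega_3^2-\alpha_1-\beta_2 .$$ Let $\mathcal P=\{\boldsymbol\alpha^2=a^2,\ \boldsymbol\beta^2=b^2,\ \boldsymbol\alpha\cdot\boldsymbol\beta=0\}$ and let $$K=(\omega_1^2-\omega_2^2+\alpha_1-\beta_2)^2+(2\omega_1\omega_2+\alpha_2+\beta_1)^2,$$ $$\begin{aligned}G={}&(\omega_1\alpha_1+\omega_2\alpha_2+\tfrac12\omega_3\alpha_3)^2+(\omega_1\beta_1+\omega_2\beta_2+\tfrac12\omega_3\beta_3)^2\\&+\omega_3[\omega_1(\alpha_2\beta_3-\alpha_3\beta_2)+\omega_2(\alpha_3\beta_1-\alpha_1\beta_3)+\tfrac12\omega_3(\alpha_1\beta_2-\alpha_2\beta_1)]\\&-\alpha_1\boldsymbol\beta^2-\beta_2\boldsymbol\alpha^2+(\alpha_2+\beta_1)(\boldsymbol\alpha\cdot\boldsymbol\beta),\end{aligned}$$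 $$F=(2G-p^2H)^2-r^4K,\quad M=\frac{2G-p^2H}{r^4},\quad \mathcal N=\{x\in\mathcal P:\ F(x)=0,\ d(F|_{\mathcal P})(x)=0\},$$ $$J_{m,h}=\{x\in\mathcal N: M(x)=m,\ H(x)=h\},\quad \Lambda=(\alpha_1-\beta_2)^2+(\alpha_2+\beta_1)^2,\quad \Delta=\alpha_1\beta_2-\alpha_2\beta_1 .$$ For $\Lambda\ne0$ and either branch $\sqrt\Lambda$ of the two-valued root let $$L=\frac{\omega_1^2+\omega_2^2+(a^2+b^2-2\Delta)M}{\sqrt\Lambda},\qquad u_1=\frac{a\sqrt\Lambda}{a^2-\Delta},\qquad u_2=\frac{b^2-\Delta}{b\sqrt\Lambda}.$$ For constants with $$\ell^2=1+2mh+2p^2m^2\tag{1}$$ let $h_*=-\tfrac12(h+p^2m)$, $f_1(u)=h_*u^2+a\ell u-a^2m$, $f_2(u)=b^2mu^2-b\ell u-h_*$, and let $$Q_i=\sqrt{1-u_i^2},\qquad P_i=\sqrt{f_i(u_i)}\qquad(i=1,2)\tag{2}$$ be two-valued radicals (real numbers with these squares). Let $\Theta=(a-bu_1u_2)^{-1}$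 and $\psi=abm\,u_2-h_*u_1-\tfrac{\ell}{2}(a+bu_1u_2)$. Consider the formulas $$\begin{aligned} \alpha_1&=-2a\Theta^2[(au_1-bu_2)\psi+bQ_1Q_2P_1P_2],&\alpha_2&=2a\Theta^2[(au_1-bu_2)P_1P_2-bQ_1Q_2\psi],\\ \beta_1&=2b\Theta^2[aQ_1Q_2\psi-(bu_1-au_2)P_1P_2],&\beta_2&=-2b\Theta^2[aQ_1Q_2P_1P_2+(bu_1-au_2)\psi],\\ \omega_1&=r(\ell u_1-2am)\Theta P_2,&\omega_2&=r(2bmu_2-\ell)\Theta P_1,\\ \alpha_3&=ar\Theta Q_1,\qquad \beta_3=br\Theta u_1Q_2,&\omega_3&=2\Theta(bQ_2P_1-aQ_1P_2). \end{aligned}\tag{3}$$ **Proposition 1.** (i) Under (1), $f_1(u)=h_*(u-\tau_1)(u-\tau_2)$ with $\tau_{1,2}=\frac{2am}{\ell\mp1}$ if $\ell\neq\pm1$, and $f_2(u)=b^2m(u-\sigma_1)(u-\sigma_2)$ with $\sigma_{1,2}=\frac{\ell\mp1}{2bm}$ if $m\ne0$. (ii) For every point of $J_{m,h}$ (with $\Lambda=0$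 allowed) there are a number $\ell$ satisfying (1), $u_1,u_2\in[-1,1]$ and values of the radicals (2) such that (3) holds. (iii) At every point of $J_{m,h}$ with $\Lambda\neq0$ and for either branch of $\sqrt\Lambda$, the functions $u_1,u_2$ lie in $[-1,1]$, $\ell=L$ satisfies (1), and there are values of the radicals (2) for which (3) holds and for which the derivatives of $u_1,u_2$ along the Euler equations are $$\dot u_1=Q_1P_1,\qquad \dot u_2=Q_2P_2.\tag{4}$$ (iv) Let $x(t)$ be a solution of the Euler equations on an open set of times which lies in $\mathcal N$ (it may meet $\Lambda=0$). Near every $t_0$ there are constants $\ell,m,h$ satisfying (1) and functions $u_i(t)\in[-1,1]$, differentiable, and $Q_i(t),P_i(t)$, continuous, such that $x(t)\in J_{m,h}$ and (2), (3), (4) hold, and such that whenever $\Lambda(x(t))\ne0$ the numbers $u_1(t),u_2(t),\ell$ are the values at $x(t)$ of the functions $u_1,u_2,L$ for one of the two branches of $\sqrt\Lambda$. -/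

import Mathlib

noncomputable section

namespace RS

/-- The space `e(3,2)*` with coordinates `(g, α, β)`, each a vector of `ℝ³`. The indices
`1, 2, 3` of the usual notation are the elements `0, 1, 2` of `Fin 3`. -/
abbrev Phase : Type := (Fin 3 → ℝ) × (Fin 3 → ℝ) × (Fin 3 → ℝ)

/-- The kinetic momentum. -/
def mom (x : Phase) : Fin 3 → ℝ := x.1

def alpha (x : Phase) : Fin 3 → ℝ := x.2.1

def beta (x : Phase) : Fin 3 → ℝ := x.2.2

/-- Gradients of a function with respect to `g`, `α` and `β`. -/
def gradG (f : Phase → ℝ) (x : Phase) : Fin 3 → ℝ :=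
  fun i => fderiv ℝ f x (Pi.single i 1, 0, 0)

def gradA (f : Phase → ℝ) (x : Phase) : Fin 3 → ℝ :=
  fun i => fderiv ℝ f x (0, Pi.single i 1, 0)

def gradB (f : Phase → ℝ) (x : Phase) : Fin 3 → ℝ :=
  fun i => fderiv ℝ f x (0, 0, Pi.single i 1)

/-- The Lie–Poisson bracket: the biderivation with
`{g_i, g_j} = -ε_{ijk} g_k`, `{g_i, α_j} = -ε_{ijk} α_k`, `{g_i, β_j} = -ε_{ijk} β_k`,
and all brackets among the `α_i, β_j` equal to zero. -/
def bracket (f₁ f₂ : Phase → ℝ) (x : Phase) : ℝ :=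
  -(mom x ⬝ᵥ crossProduct (gradG f₁ x) (gradG f₂ x)
    + alpha x ⬝ᵥ (crossProduct (gradG f₁ x) (gradA f₂ x)
        + crossProduct (gradA f₁ x) (gradG f₂ x))
    + beta x ⬝ᵥ (crossProduct (gradG f₁ x) (gradB f₂ x)
        + crossProduct (gradB f₁ x) (gradG f₂ x)))

/-- The vector field of the Euler equations `ẋ = {x, H}`. -/
def eulerField (Ham : Phase → ℝ) (x : Phase) : Phase :=
  (fun i => bracket (fun y => mom y i) Ham x,
    fun i => bracket (fun y => alpha y i) Ham x,
    fun i => bracket (fun y => beta y i) Ham x)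

/-- The principal moments of inertia of the Kowalevski top, `I = diag(2, 2, 1)`. -/
def inertia : Fin 3 → ℝ := ![2, 2, 1]

/-- The angular velocity `ω = I⁻¹ g`. -/
def omega (x : Phase) : Fin 3 → ℝ := fun i => mom x i / inertia i

/-- The Hamilton function. It equals `½ g · I⁻¹ g - α₁ - β₂`. -/
def H (x : Phase) : ℝ :=
  omega x 0 ^ 2 + omega x 1 ^ 2 + omega x 2 ^ 2 / 2 - alpha x 0 - beta x 1

def K (x : Phase) : ℝ :=
  (omega x 0 ^ 2 - omega x 1 ^ 2 + alpha x 0 - beta x 1) ^ 2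
    + (2 * omega x 0 * omega x 1 + alpha x 1 + beta x 0) ^ 2

def G (x : Phase) : ℝ :=
  (omega x 0 * alpha x 0 + omega x 1 * alpha x 1 + omega x 2 * alpha x 2 / 2) ^ 2
    + (omega x 0 * beta x 0 + omega x 1 * beta x 1 + omega x 2 * beta x 2 / 2) ^ 2
    + omega x 2 * (omega x 0 * (alpha x 1 * beta x 2 - alpha x 2 * beta x 1)
        + omega x 1 * (alpha x 2 * beta x 0 - alpha x 0 * beta x 2)
        + omega x 2 * (alpha x 0 * beta x 1 - alpha x 1 * beta x 0) / 2)
    - alpha x 0 * (beta x ⬝ᵥ beta x) - beta x 1 * (alpha x ⬝ᵥ alpha x)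
    + (alpha x 1 + beta x 0) * (alpha x ⬝ᵥ beta x)

/-- `p = √(a² + b²)`. -/
def p (a b : ℝ) : ℝ := √(a ^ 2 + b ^ 2)

/-- `r = √(a² - b²)`. -/
def r (a b : ℝ) : ℝ := √(a ^ 2 - b ^ 2)

/-- The symplectic leaf `α² = a²`, `β² = b²`, `α · β = 0`. -/
def leaf (a b : ℝ) : Set Phase :=
  {x | alpha x ⬝ᵥ alpha x = a ^ 2 ∧ beta x ⬝ᵥ beta x = b ^ 2 ∧ alpha x ⬝ᵥ beta x = 0}

/-- `v` is tangent at `x` to the common level of `α²`, `β²`, `α · β`. -/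
def IsTangent (x v : Phase) : Prop :=
  alpha x ⬝ᵥ alpha v = 0 ∧ beta x ⬝ᵥ beta v = 0 ∧
    alpha x ⬝ᵥ beta v + beta x ⬝ᵥ alpha v = 0

def F (a b : ℝ) (x : Phase) : ℝ :=
  (2 * G x - p a b ^ 2 * H x) ^ 2 - r a b ^ 4 * K x

/-- The critical subsystem: the points of the leaf where `F = 0` and where the differential
of the restriction of `F` to the leaf vanishes. -/
def N (a b : ℝ) : Set Phase :=
  {x | x ∈ leaf a b ∧ F a b x = 0 ∧ ∀ v, IsTangent x v → fderiv ℝ (F a b) x v = 0}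

def M (a b : ℝ) (x : Phase) : ℝ := (2 * G x - p a b ^ 2 * H x) / r a b ^ 4

/-- The integral manifold `J_{m,h}`. -/
def J (a b m h : ℝ) : Set Phase := {x | x ∈ N a b ∧ M a b x = m ∧ H x = h}

def Lam (x : Phase) : ℝ := (alpha x 0 - beta x 1) ^ 2 + (alpha x 1 + beta x 0) ^ 2

/-- `α₁β₂ - α₂β₁`. -/
def minor (x : Phase) : ℝ := alpha x 0 * beta x 1 - alpha x 1 * beta x 0

/-- The branch `ε √Λ`, `ε = ±1`, of the two-valued square root of `Λ`. -/
def rootLam (ε : ℝ) (x : Phase) : ℝ := ε * √(Lam x)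

/-- The partial integral `L`, for the branch `ε √Λ`. -/
def L (a b ε : ℝ) (x : Phase) : ℝ :=
  1 / rootLam ε x *
    (omega x 0 ^ 2 + omega x 1 ^ 2 + (a ^ 2 + b ^ 2 - 2 * minor x) * M a b x)

/-- The separation variable `u₁`, for the branch `ε √Λ`. -/
def sepU₁ (a ε : ℝ) (x : Phase) : ℝ := a * rootLam ε x / (a ^ 2 - minor x)

/-- The separation variable `u₂`, for the branch `ε √Λ`. -/
def sepU₂ (b ε : ℝ) (x : Phase) : ℝ := (b ^ 2 - minor x) / (b * rootLam ε x)

/-- Values of the variables `u₁, u₂` and of the radicals `Q₁, P₁, Q₂, P₂`. -/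
structure SepPoint where
  u₁ : ℝ
  Q₁ : ℝ
  P₁ : ℝ
  u₂ : ℝ
  Q₂ : ℝ
  P₂ : ℝ

/-- The relation between the integral constants. -/
def ConstRel (a b ℓ m h : ℝ) : Prop := ℓ ^ 2 = 1 + 2 * m * h + 2 * p a b ^ 2 * m ^ 2

def hStar (a b m h : ℝ) : ℝ := -(h + p a b ^ 2 * m) / 2

/-- The radicand of `P₁`. -/
def f₁ (a b ℓ m h u : ℝ) : ℝ := hStar a b m h * u ^ 2 + a * ℓ * u - a ^ 2 * m

/-- The radicand of `P₂`. -/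
def f₂ (a b ℓ m h u : ℝ) : ℝ := b ^ 2 * m * u ^ 2 - b * ℓ * u - hStar a b m h

/-- `y` carries some values of the two-valued radicals
`Q_i = √(1 - u_i²)`, `P_i = √(f_i(u_i))`. -/
def IsSepPoint (a b ℓ m h : ℝ) (y : SepPoint) : Prop :=
  y.Q₁ ^ 2 = 1 - y.u₁ ^ 2 ∧ y.P₁ ^ 2 = f₁ a b ℓ m h y.u₁ ∧
    y.Q₂ ^ 2 = 1 - y.u₂ ^ 2 ∧ y.P₂ ^ 2 = f₂ a b ℓ m h y.u₂

def Theta (a b : ℝ) (y : SepPoint) : ℝ := 1 / (a - b * y.u₁ * y.u₂)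

def psi (a b ℓ m h : ℝ) (y : SepPoint) : ℝ :=
  a * b * m * y.u₂ - hStar a b m h * y.u₁ - ℓ / 2 * (a + b * y.u₁ * y.u₂)

def alphaOf (a b ℓ m h : ℝ) (y : SepPoint) : Fin 3 → ℝ :=
  ![-(2 * a * Theta a b y ^ 2 * ((a * y.u₁ - b * y.u₂) * psi a b ℓ m h y
        + b * y.Q₁ * y.Q₂ * y.P₁ * y.P₂)),
    2 * a * Theta a b y ^ 2 * ((a * y.u₁ - b * y.u₂) * y.P₁ * y.P₂
        - b * y.Q₁ * y.Q₂ * psi a b ℓ m h y),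
    a * r a b * Theta a b y * y.Q₁]

def betaOf (a b ℓ m h : ℝ) (y : SepPoint) : Fin 3 → ℝ :=
  ![2 * b * Theta a b y ^ 2 * (a * y.Q₁ * y.Q₂ * psi a b ℓ m h y
        - (b * y.u₁ - a * y.u₂) * y.P₁ * y.P₂),
    -(2 * b * Theta a b y ^ 2 * (a * y.Q₁ * y.Q₂ * y.P₁ * y.P₂
        + (b * y.u₁ - a * y.u₂) * psi a b ℓ m h y)),
    b * r a b * Theta a b y * y.u₁ * y.Q₂]

def omegaOf (a b ℓ m : ℝ) (y : SepPoint) : Fin 3 → ℝ :=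
  ![r a b * (ℓ * y.u₁ - 2 * a * m) * Theta a b y * y.P₂,
    r a b * (2 * b * m * y.u₂ - ℓ) * Theta a b y * y.P₁,
    2 * Theta a b y * (b * y.Q₂ * y.P₁ - a * y.Q₁ * y.P₂)]

/-- The phase variables of `x` are expressed through `y` and the constants `ℓ, m, h`. -/
def Expresses (a b ℓ m h : ℝ) (y : SepPoint) (x : Phase) : Prop :=
  alpha x = alphaOf a b ℓ m h y ∧ beta x = betaOf a b ℓ m h y ∧ omega x = omegaOf a b ℓ m y

end RS

end

noncomputable section

namespace RS

/-! ### Derivatives along curves -/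

/-! Write w = ω₁ + iω₂, x₁ = (α₁ - β₂) + i(α₂ + β₁), z = α₃ + iβ₃, and let a bar denote conjugation,
so that Λ = |x₁|² and K = |w² + x₁|². On the leaf, 2Λ(2G - p²H) + c² = 2r² Re(x̄₁²(w² + x₁)) with c
= `critOmega x` (`leaf_critOmega_sq`). Since K does not contain ω₃, criticality in ω₃ forces c = 0
on `N` (`N_critOmega`). Then F = 0 says that x̄₁²(w² + x₁) has the same modulus as its real part,
hence is real (`J_kappa`). Where Λ ≠ 0 this amounts to (x̄₁w)² = Λ(r²m - x̄₁), while c = 0 reads Λω₃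
= 2 Re(x̄₁wz). With the value of H these give the relation (1) and show that P₁, P₂ are, up to
explicit factors, the imaginary and real parts of x̄₁w; the leaf equations show that Q₁, Q₂ are α₃,
β₃ up to factors. Substitution then gives (3) (`expresses_sepPointOf`).

Where Λ = 0 the leaf equations leave few free variables and u₁ = 0; one more tangent direction of dF
yields ω₃ when m ≠ 0, and the remaining variables are solved from (3) by hand
(`exists_sepPoint_of_lam_eq_zero`).

For the dynamics, u, Q, P are treated as six independent variables with a polynomial vector field,
so branch points of the radicals are harmless and the relations (2) are conserved. Formulas (3)
carry its solutions to solutions of the Euler equations (`hasDerivAt_phaseOf`). Uniqueness for the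
Euler equations then identifies any motion in `N`, near any time, with the image of such a solution;
the passage through Λ = 0 needs no separate argument (`exists_sepCurve`). The same curves give the
derivatives of the explicit functions u₁, u₂ (`hasDerivAt_sepU`). -/

theorem hasDerivAt_mom {γ : ℝ → Phase} {v : Phase} {t : ℝ} (h : HasDerivAt γ v t) (i : Fin 3) :
    HasDerivAt (fun s => mom (γ s) i) (mom v i) t :=
  hasDerivAt_pi.1 h.fst i

theorem hasDerivAt_alpha {γ : ℝ → Phase} {v : Phase} {t : ℝ} (h : HasDerivAt γ v t) (i : Fin 3) :
    HasDerivAt (fun s => alpha (γ s) i) (alpha v i) t :=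
  hasDerivAt_pi.1 h.snd.fst i

theorem hasDerivAt_beta {γ : ℝ → Phase} {v : Phase} {t : ℝ} (h : HasDerivAt γ v t) (i : Fin 3) :
    HasDerivAt (fun s => beta (γ s) i) (beta v i) t :=
  hasDerivAt_pi.1 h.snd.snd i

theorem hasDerivAt_omega {γ : ℝ → Phase} {v : Phase} {t : ℝ} (h : HasDerivAt γ v t) (i : Fin 3) :
    HasDerivAt (fun s => omega (γ s) i) (omega v i) t :=
  (hasDerivAt_mom h i).div_const _

/-- The directional derivative of `H`. -/
def dH (x v : Phase) : ℝ :=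
  2 * omega x 0 * omega v 0 + 2 * omega x 1 * omega v 1 + omega x 2 * omega v 2
    - alpha v 0 - beta v 1

theorem hasDerivAt_H {γ : ℝ → Phase} {v : Phase} {t : ℝ} (h : HasDerivAt γ v t) :
    HasDerivAt (fun s => H (γ s)) (dH (γ t) v) t := by
  have w := hasDerivAt_omega h
  refine ((((((w 0).pow 2).add ((w 1).pow 2)).add (((w 2).pow 2).div_const 2)).sub
    (hasDerivAt_alpha h 0)).sub (hasDerivAt_beta h 1)).congr_deriv ?_
  simp only [dH]; push_cast; ring

/-- The directional derivative of `K`. -/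
def dK (x v : Phase) : ℝ :=
  2 * (omega x 0 ^ 2 - omega x 1 ^ 2 + alpha x 0 - beta x 1)
      * (2 * omega x 0 * omega v 0 - 2 * omega x 1 * omega v 1 + alpha v 0 - beta v 1)
    + 2 * (2 * omega x 0 * omega x 1 + alpha x 1 + beta x 0)
      * (2 * omega v 0 * omega x 1 + 2 * omega x 0 * omega v 1 + alpha v 1 + beta v 0)

theorem hasDerivAt_K {γ : ℝ → Phase} {v : Phase} {t : ℝ} (h : HasDerivAt γ v t) :
    HasDerivAt (fun s => K (γ s)) (dK (γ t) v) t := by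
  have w := hasDerivAt_omega h
  have α := hasDerivAt_alpha h
  have β := hasDerivAt_beta h
  refine (((((((w 0).pow 2).sub ((w 1).pow 2)).add (α 0)).sub (β 1)).pow 2).add
    ((((((w 0).const_mul 2).mul (w 1)).add (α 1)).add (β 0)).pow 2)).congr_deriv ?_
  simp only [dK, Pi.add_apply, Pi.sub_apply, Pi.mul_apply, Pi.pow_apply]; push_cast; ring

/-- The directional derivative of `G`. -/
def dG (x v : Phase) : ℝ :=
  2 * (omega x 0 * alpha x 0 + omega x 1 * alpha x 1 + omega x 2 * alpha x 2 / 2)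
      * (omega v 0 * alpha x 0 + omega v 1 * alpha x 1 + omega v 2 * alpha x 2 / 2
        + (omega x 0 * alpha v 0 + omega x 1 * alpha v 1 + omega x 2 * alpha v 2 / 2))
    + 2 * (omega x 0 * beta x 0 + omega x 1 * beta x 1 + omega x 2 * beta x 2 / 2)
      * (omega v 0 * beta x 0 + omega v 1 * beta x 1 + omega v 2 * beta x 2 / 2
        + (omega x 0 * beta v 0 + omega x 1 * beta v 1 + omega x 2 * beta v 2 / 2))
    + omega v 2 * (omega x 0 * (alpha x 1 * beta x 2 - alpha x 2 * beta x 1)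
        + omega x 1 * (alpha x 2 * beta x 0 - alpha x 0 * beta x 2)
        + omega x 2 * (alpha x 0 * beta x 1 - alpha x 1 * beta x 0) / 2)
    + omega x 2 * (omega v 0 * (alpha x 1 * beta x 2 - alpha x 2 * beta x 1)
        + omega v 1 * (alpha x 2 * beta x 0 - alpha x 0 * beta x 2)
        + omega v 2 * (alpha x 0 * beta x 1 - alpha x 1 * beta x 0) / 2
        + omega x 0 * (alpha v 1 * beta x 2 - alpha v 2 * beta x 1
          + alpha x 1 * beta v 2 - alpha x 2 * beta v 1)
        + omega x 1 * (alpha v 2 * beta x 0 - alpha v 0 * beta x 2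
          + alpha x 2 * beta v 0 - alpha x 0 * beta v 2)
        + omega x 2 * (alpha v 0 * beta x 1 - alpha v 1 * beta x 0
          + alpha x 0 * beta v 1 - alpha x 1 * beta v 0) / 2)
    - alpha v 0 * (beta x 0 ^ 2 + beta x 1 ^ 2 + beta x 2 ^ 2)
    - alpha x 0 * (2 * (beta x 0 * beta v 0 + beta x 1 * beta v 1 + beta x 2 * beta v 2))
    - beta v 1 * (alpha x 0 ^ 2 + alpha x 1 ^ 2 + alpha x 2 ^ 2)
    - beta x 1 * (2 * (alpha x 0 * alpha v 0 + alpha x 1 * alpha v 1 + alpha x 2 * alpha v 2))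
    + (alpha v 1 + beta v 0)
      * (alpha x 0 * beta x 0 + alpha x 1 * beta x 1 + alpha x 2 * beta x 2)
    + (alpha x 1 + beta x 0)
      * (alpha v 0 * beta x 0 + alpha v 1 * beta x 1 + alpha v 2 * beta x 2
        + (alpha x 0 * beta v 0 + alpha x 1 * beta v 1 + alpha x 2 * beta v 2))

theorem dot_eq (u v : Fin 3 → ℝ) : u ⬝ᵥ v = u 0 * v 0 + u 1 * v 1 + u 2 * v 2 := by
  simp [dotProduct, Fin.sum_univ_three]

theorem hasDerivAt_G {γ : ℝ → Phase} {v : Phase} {t : ℝ} (h : HasDerivAt γ v t) :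
    HasDerivAt (fun s => G (γ s)) (dG (γ t) v) t := by
  have w := hasDerivAt_omega h
  have α := hasDerivAt_alpha h
  have β := hasDerivAt_beta h
  have dot {f₁ f₂ : Fin 3 → ℝ → ℝ} {d₁ d₂ : Fin 3 → ℝ} (h₁ : ∀ i, HasDerivAt (f₁ i) (d₁ i) t)
      (h₂ : ∀ i, HasDerivAt (f₂ i) (d₂ i) t) :=
    (((h₁ 0).mul (h₂ 0)).add ((h₁ 1).mul (h₂ 1))).add ((h₁ 2).mul (h₂ 2))
  have form {f : Fin 3 → ℝ → ℝ} {d : Fin 3 → ℝ} (h₁ : ∀ i, HasDerivAt (f i) (d i) t) :=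
    (((w 0).mul (h₁ 0)).add ((w 1).mul (h₁ 1))).add (((w 2).mul (h₁ 2)).div_const 2)
  have minorD (i j : Fin 3) := ((α i).mul (β j)).sub ((α j).mul (β i))
  have key := (((((form α).pow 2).add ((form β).pow 2)).add
    ((w 2).mul ((((w 0).mul (minorD 1 2)).add ((w 1).mul (minorD 2 0))).add
      (((w 2).mul (minorD 0 1)).div_const 2)))).sub ((α 0).mul (dot β β))).sub
    ((β 1).mul (dot α α)) |>.add (((α 1).add (β 0)).mul (dot α β))
  refine (key.congr_deriv ?_).congr_of_eventuallyEq (.of_forall fun s => ?_)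
  · simp only [dG, Pi.add_apply, Pi.sub_apply, Pi.mul_apply]; push_cast; ring
  · simp only [G, dot_eq, Pi.add_apply, Pi.sub_apply, Pi.mul_apply, Pi.pow_apply]

/-! ### Differentiability of the integrals and their differentials -/

theorem differentiable_omega (i : Fin 3) : Differentiable ℝ fun x => omega x i := by
  unfold omega mom; fun_prop

theorem differentiable_alpha (i : Fin 3) : Differentiable ℝ fun x => alpha x i := by
  unfold alpha; fun_prop

theorem differentiable_beta (i : Fin 3) : Differentiable ℝ fun x => beta x i := by
  unfold beta; fun_prop

theorem differentiable_H : Differentiable ℝ H := by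
  have := differentiable_omega; have := differentiable_alpha; have := differentiable_beta
  unfold H; fun_prop

theorem differentiable_K : Differentiable ℝ K := by
  have := differentiable_omega; have := differentiable_alpha; have := differentiable_beta
  unfold K; fun_prop

theorem differentiable_G : Differentiable ℝ G := by
  have := differentiable_omega; have := differentiable_alpha; have := differentiable_beta
  unfold G; simp only [dot_eq]; fun_prop

theorem differentiable_F (a b : ℝ) : Differentiable ℝ (F a b) := by
  have := differentiable_H; have := differentiable_K; have := differentiable_G
  unfold F; fun_prop

/-- A differential can be read off from any one curve with the given velocity. Straight lines give
the differentials used for the criticality condition and the bracket. -/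
theorem fderiv_eq_of_hasDerivAt_comp {f : Phase → ℝ} {x v : Phase} {γ : ℝ → Phase} {t d : ℝ}
    (hf : DifferentiableAt ℝ f x) (hx : γ t = x) (hγ : HasDerivAt γ v t)
    (hd : HasDerivAt (fun s => f (γ s)) d t) : fderiv ℝ f x v = d := by
  subst hx
  exact (hf.hasFDerivAt.comp_hasDerivAt t hγ).unique hd

theorem hasDerivAt_line (x v : Phase) : HasDerivAt (fun s : ℝ => x + s • v) v 0 := by
  simpa using ((hasDerivAt_id (0 : ℝ)).smul_const v).const_add x

theorem fderiv_H (x v : Phase) : fderiv ℝ H x v = dH x v := by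
  have h := hasDerivAt_H (hasDerivAt_line x v)
  simp only [zero_smul, add_zero] at h
  exact fderiv_eq_of_hasDerivAt_comp (differentiable_H x) (by simp) (hasDerivAt_line x v) h

theorem fderiv_F (a b : ℝ) (x v : Phase) : fderiv ℝ (F a b) x v =
    2 * (2 * G x - p a b ^ 2 * H x) * (2 * dG x v - p a b ^ 2 * dH x v)
      - r a b ^ 4 * dK x v := by
  have l := hasDerivAt_line x v
  have h := ((((hasDerivAt_G l).const_mul 2).sub ((hasDerivAt_H l).const_mul (p a b ^ 2))).pow
    2).sub ((hasDerivAt_K l).const_mul (r a b ^ 4))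
  refine fderiv_eq_of_hasDerivAt_comp (differentiable_F a b x) (by simp) l (h.congr_deriv ?_)
  simp

theorem fderiv_mom (x v : Phase) (i : Fin 3) : fderiv ℝ (fun y => mom y i) x v = mom v i :=
  fderiv_eq_of_hasDerivAt_comp (by unfold mom; fun_prop) (by simp) (hasDerivAt_line x v)
    (hasDerivAt_mom (hasDerivAt_line x v) i)

theorem fderiv_alpha (x v : Phase) (i : Fin 3) : fderiv ℝ (fun y => alpha y i) x v = alpha v i :=
  fderiv_eq_of_hasDerivAt_comp (differentiable_alpha i x) (by simp) (hasDerivAt_line x v)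
    (hasDerivAt_alpha (hasDerivAt_line x v) i)

theorem fderiv_beta (x v : Phase) (i : Fin 3) : fderiv ℝ (fun y => beta y i) x v = beta v i :=
  fderiv_eq_of_hasDerivAt_comp (differentiable_beta i x) (by simp) (hasDerivAt_line x v)
    (hasDerivAt_beta (hasDerivAt_line x v) i)

/-- The point with given `ω, α, β`. -/
def ofOmega (w α β : Fin 3 → ℝ) : Phase := (fun i => inertia i * w i, α, β)

@[simp] theorem alpha_ofOmega (w α β : Fin 3 → ℝ) : alpha (ofOmega w α β) = α := rfl

@[simp] theorem beta_ofOmega (w α β : Fin 3 → ℝ) : beta (ofOmega w α β) = β := rfl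

@[simp] theorem omega_ofOmega (w α β : Fin 3 → ℝ) : omega (ofOmega w α β) = w := by
  funext i
  fin_cases i <;> simp [omega, ofOmega, mom, inertia]

theorem ofOmega_eta (x : Phase) : ofOmega (omega x) (alpha x) (beta x) = x := by
  refine Prod.ext ?_ rfl
  funext i
  fin_cases i <;> simp [omega, ofOmega, mom, inertia] <;> ring

theorem gradG_apply (f : Phase → ℝ) (x : Phase) (i : Fin 3) :
    gradG f x i = fderiv ℝ f x (Pi.single i 1, 0, 0) := rfl

theorem gradA_apply (f : Phase → ℝ) (x : Phase) (i : Fin 3) :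
    gradA f x i = fderiv ℝ f x (0, Pi.single i 1, 0) := rfl

theorem gradB_apply (f : Phase → ℝ) (x : Phase) (i : Fin 3) :
    gradB f x i = fderiv ℝ f x (0, 0, Pi.single i 1) := rfl

theorem cross_zero (u v : Fin 3 → ℝ) : crossProduct u v 0 = u 1 * v 2 - u 2 * v 1 := by
  simp [cross_apply]

theorem cross_one (u v : Fin 3 → ℝ) : crossProduct u v 1 = u 2 * v 0 - u 0 * v 2 := by
  simp [cross_apply]

theorem cross_two (u v : Fin 3 → ℝ) : crossProduct u v 2 = u 0 * v 1 - u 1 * v 0 := by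
  simp [cross_apply]

/-- The Euler equations in the variables `ω, α, β`. -/
theorem eulerField_H (x : Phase) : eulerField H x = ofOmega
    ![(omega x 1 * omega x 2 + beta x 2) / 2, -(omega x 0 * omega x 2 + alpha x 2) / 2,
      alpha x 1 - beta x 0]
    ![alpha x 1 * omega x 2 - alpha x 2 * omega x 1,
      alpha x 2 * omega x 0 - alpha x 0 * omega x 2,
      alpha x 0 * omega x 1 - alpha x 1 * omega x 0]
    ![beta x 1 * omega x 2 - beta x 2 * omega x 1,
      beta x 2 * omega x 0 - beta x 0 * omega x 2,
      beta x 0 * omega x 1 - beta x 1 * omega x 0] := by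
  refine Prod.ext ?_ (Prod.ext ?_ ?_) <;> funext i <;> fin_cases i <;>
    simp only [eulerField, bracket, dot_eq, Pi.add_apply, cross_zero, cross_one, cross_two,
      gradG_apply, gradA_apply, gradB_apply, fderiv_H, fderiv_mom, fderiv_alpha, fderiv_beta] <;>
    simp [ofOmega, dH, omega, alpha, beta, mom, inertia] <;> ring

theorem p_sq (a b : ℝ) : p a b ^ 2 = a ^ 2 + b ^ 2 := Real.sq_sqrt (by positivity)

theorem r_sq {a b : ℝ} (hb : 0 < b) (hab : b < a) : r a b ^ 2 = a ^ 2 - b ^ 2 :=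
  Real.sq_sqrt (by nlinarith)

theorem r_pos {a b : ℝ} (hb : 0 < b) (hab : b < a) : 0 < r a b :=
  Real.sqrt_pos.2 (by nlinarith)

/-- In this form the relation says that f₁ and f₂ have discriminants a² and b². -/
theorem constRel_iff {a b ℓ m h : ℝ} : ConstRel a b ℓ m h ↔ ℓ ^ 2 + 4 * m * hStar a b m h = 1 := by
  unfold ConstRel hStar
  constructor <;> intro H <;> linear_combination H

/-! ### The expressions of the phase variables in polar form -/

/-- The real part of the unit number `2Θ(ψ - iP₁P₂)`. -/
def cosE (a b ℓ m h : ℝ) (y : SepPoint) : ℝ := 2 * Theta a b y * psi a b ℓ m h y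

/-- Minus the imaginary part of the unit number `2Θ(ψ - iP₁P₂)`. -/
def sinE (a b : ℝ) (y : SepPoint) : ℝ := 2 * Theta a b y * (y.P₁ * y.P₂)

section Polar

variable {a b ℓ m h : ℝ} {y : SepPoint}

theorem Theta_mul (hD : a - b * y.u₁ * y.u₂ ≠ 0) : Theta a b y * (a - b * y.u₁ * y.u₂) = 1 :=
  one_div_mul_cancel hD

/-- The identity ψ² + f₁f₂ = (ℓ² + 4mh_*)(a - bu₁u₂)²/4 turns the relation between the constants
into |e| = 1 for e = `cosE` - i `sinE`. With A = (au₁ - bu₂) + ibQ₁Q₂ and B = (bu₁ - au₂) + iaQ₁Q₂,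
the lemmas below put (3) into the form α₁ + iα₂ = -aΘAe, -β₂ + iβ₁ = bΘBe, ω₁ + iω₂ = rΘ(u₁P₂ +
iP₁)e. -/
theorem cosE_sq_add_sinE_sq (hD : a - b * y.u₁ * y.u₂ ≠ 0) (hc : ConstRel a b ℓ m h)
    (hy : IsSepPoint a b ℓ m h y) : cosE a b ℓ m h y ^ 2 + sinE a b y ^ 2 = 1 := by
  obtain ⟨-, hP₁, -, hP₂⟩ := hy
  have hT := Theta_mul hD
  rw [constRel_iff] at hc
  have key : psi a b ℓ m h y ^ 2 + y.P₁ ^ 2 * y.P₂ ^ 2 = (a - b * y.u₁ * y.u₂) ^ 2 / 4 := by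
    rw [hP₁, hP₂]
    simp only [psi, f₁, f₂]
    linear_combination (a - b * y.u₁ * y.u₂) ^ 2 / 4 * hc
  simp only [cosE, sinE]
  linear_combination 4 * Theta a b y ^ 2 * key +
    (Theta a b y * (a - b * y.u₁ * y.u₂) + 1) * hT

theorem alphaOf_zero : alphaOf a b ℓ m h y 0 = -(a * Theta a b y *
    ((a * y.u₁ - b * y.u₂) * cosE a b ℓ m h y + b * y.Q₁ * y.Q₂ * sinE a b y)) := by
  simp only [alphaOf, cosE, sinE, Matrix.cons_val]; ring

theorem alphaOf_one : alphaOf a b ℓ m h y 1 = a * Theta a b y *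
    ((a * y.u₁ - b * y.u₂) * sinE a b y - b * y.Q₁ * y.Q₂ * cosE a b ℓ m h y) := by
  simp only [alphaOf, cosE, sinE, Matrix.cons_val]; ring

theorem alphaOf_two : alphaOf a b ℓ m h y 2 = a * r a b * Theta a b y * y.Q₁ := rfl

theorem betaOf_zero : betaOf a b ℓ m h y 0 = b * Theta a b y *
    (a * y.Q₁ * y.Q₂ * cosE a b ℓ m h y - (b * y.u₁ - a * y.u₂) * sinE a b y) := by
  simp only [betaOf, cosE, sinE, Matrix.cons_val]; ring

theorem betaOf_one : betaOf a b ℓ m h y 1 = -(b * Theta a b y *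
    (a * y.Q₁ * y.Q₂ * sinE a b y + (b * y.u₁ - a * y.u₂) * cosE a b ℓ m h y)) := by
  simp only [betaOf, cosE, sinE, Matrix.cons_val]; ring

theorem betaOf_two : betaOf a b ℓ m h y 2 = b * r a b * Theta a b y * y.u₁ * y.Q₂ := rfl

/-- Rests on u₁ψ + f₁(u₁) = (a - bu₁u₂)(ℓu₁ - 2am)/2, whose first factor cancels one Θ. -/
theorem omegaOf_zero (hD : a - b * y.u₁ * y.u₂ ≠ 0) (hy : IsSepPoint a b ℓ m h y) :
    omegaOf a b ℓ m y 0 =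
      r a b * Theta a b y * (y.u₁ * y.P₂ * cosE a b ℓ m h y + y.P₁ * sinE a b y) := by
  obtain ⟨-, hP₁, -, -⟩ := hy
  have hT := Theta_mul hD
  simp only [omegaOf, cosE, sinE, Matrix.cons_val]
  simp only [psi, f₁] at *
  linear_combination -2 * r a b * Theta a b y ^ 2 * y.P₂ * hP₁
    - r a b * Theta a b y * y.P₂ * (ℓ * y.u₁ - 2 * a * m) * hT

theorem omegaOf_one (hD : a - b * y.u₁ * y.u₂ ≠ 0) (hy : IsSepPoint a b ℓ m h y) :
    omegaOf a b ℓ m y 1 =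
      r a b * Theta a b y * (y.P₁ * cosE a b ℓ m h y - y.u₁ * y.P₂ * sinE a b y) := by
  obtain ⟨-, -, -, hP₂⟩ := hy
  have hT := Theta_mul hD
  simp only [omegaOf, cosE, sinE, Matrix.cons_val]
  simp only [psi, f₂] at *
  linear_combination 2 * r a b * Theta a b y ^ 2 * y.P₁ * y.u₁ * hP₂
    - r a b * Theta a b y * y.P₁ * (2 * b * m * y.u₂ - ℓ) * hT

theorem omegaOf_two : omegaOf a b ℓ m y 2 =
    2 * Theta a b y * (b * y.Q₂ * y.P₁ - a * y.Q₁ * y.P₂) := rfl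

end Polar

/-! ### The functions of the phase point in terms of the separation variables -/

theorem abs_le_one_of_sq {u Q : ℝ} (h : Q ^ 2 = 1 - u ^ 2) : |u| ≤ 1 :=
  (sq_le_one_iff_abs_le_one u).1 (by nlinarith [sq_nonneg Q])

theorem sub_mul_mul_pos {a b u₁ u₂ : ℝ} (hb : 0 < b) (hab : b < a) (h₁ : |u₁| ≤ 1)
    (h₂ : |u₂| ≤ 1) : 0 < a - b * u₁ * u₂ := by
  have h : |u₁ * u₂| ≤ 1 := by
    rw [abs_mul]; exact mul_le_one₀ h₁ (abs_nonneg _) h₂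
  nlinarith [le_abs_self (u₁ * u₂)]

section Inverse

variable {a b ℓ m h : ℝ} {y : SepPoint} {x : Phase}

theorem IsSepPoint.sub_pos (hb : 0 < b) (hab : b < a) (hy : IsSepPoint a b ℓ m h y) :
    0 < a - b * y.u₁ * y.u₂ :=
  sub_mul_mul_pos hb hab (abs_le_one_of_sq hy.1) (abs_le_one_of_sq hy.2.2.1)

/-- Since bB - aA = -r²u₁ is real, the polar form gives x₁ = -r²Θu₁e with |e| = 1. In particular u₁
vanishes exactly where Λ does. -/
theorem Expresses.lam_eq (hb : 0 < b) (hab : b < a) (hc : ConstRel a b ℓ m h)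
    (hy : IsSepPoint a b ℓ m h y) (hx : Expresses a b ℓ m h y x) :
    Lam x = (r a b ^ 2 * Theta a b y * y.u₁) ^ 2 := by
  have hE := cosE_sq_add_sinE_sq (hy.sub_pos hb hab).ne' hc hy
  rw [Lam, hx.1, hx.2.1, alphaOf_zero, alphaOf_one, betaOf_zero, betaOf_one, r_sq hb hab]
  linear_combination ((a ^ 2 - b ^ 2) * Theta a b y * y.u₁) ^ 2 * hE

theorem Expresses.minor_eq (hb : 0 < b) (hab : b < a) (hc : ConstRel a b ℓ m h)
    (hy : IsSepPoint a b ℓ m h y) (hx : Expresses a b ℓ m h y x) :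
    minor x = a ^ 2 - a * r a b ^ 2 * Theta a b y := by
  have hD := (hy.sub_pos hb hab).ne'
  have hE := cosE_sq_add_sinE_sq hD hc hy
  have hT := Theta_mul hD
  obtain ⟨hQ₁, -, hQ₂, -⟩ := hy
  rw [minor, hx.1, hx.2.1, alphaOf_zero, alphaOf_one, betaOf_zero, betaOf_one, r_sq hb hab]
  have h₁ : (a * y.u₁ - b * y.u₂) * (b * y.u₁ - a * y.u₂) + a * b * (y.Q₁ ^ 2 * y.Q₂ ^ 2)
      = a * b - (a ^ 2 + b ^ 2) * y.u₁ * y.u₂ + a * b * y.u₁ ^ 2 * y.u₂ ^ 2 := by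
    rw [hQ₁, hQ₂]; ring
  have h₂ : a * b * (a * b - (a ^ 2 + b ^ 2) * y.u₁ * y.u₂ + a * b * y.u₁ ^ 2 * y.u₂ ^ 2)
      = a ^ 2 * (a - b * y.u₁ * y.u₂) ^ 2 - a * (a ^ 2 - b ^ 2) * (a - b * y.u₁ * y.u₂) := by
    ring
  linear_combination a * b * Theta a b y ^ 2 * ((a * y.u₁ - b * y.u₂) * (b * y.u₁ - a * y.u₂)
      + a * b * (y.Q₁ ^ 2 * y.Q₂ ^ 2)) * hE + a * b * Theta a b y ^ 2 * h₁
    + Theta a b y ^ 2 * h₂ + (a ^ 2 * (Theta a b y * (a - b * y.u₁ * y.u₂) + 1)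
      - a * (a ^ 2 - b ^ 2) * Theta a b y) * hT

theorem Expresses.omega_sq (hb : 0 < b) (hab : b < a) (hc : ConstRel a b ℓ m h)
    (hy : IsSepPoint a b ℓ m h y) (hx : Expresses a b ℓ m h y x) :
    omega x 0 ^ 2 + omega x 1 ^ 2
      = r a b ^ 2 * Theta a b y * (ℓ * y.u₁ - m * (a + b * y.u₁ * y.u₂)) := by
  have hD := (hy.sub_pos hb hab).ne'
  have hE := cosE_sq_add_sinE_sq hD hc hy
  have hT := Theta_mul hD
  have h₁ : y.u₁ ^ 2 * y.P₂ ^ 2 + y.P₁ ^ 2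
      = (a - b * y.u₁ * y.u₂) * (ℓ * y.u₁ - m * (a + b * y.u₁ * y.u₂)) := by
    rw [hy.2.1, hy.2.2.2]; simp only [f₁, f₂]; ring
  rw [hx.2.2, omegaOf_zero hD hy, omegaOf_one hD hy]
  linear_combination (r a b * Theta a b y) ^ 2 * (y.u₁ ^ 2 * y.P₂ ^ 2 + y.P₁ ^ 2) * hE
    + (r a b * Theta a b y) ^ 2 * h₁
    + r a b ^ 2 * Theta a b y * (ℓ * y.u₁ - m * (a + b * y.u₁ * y.u₂)) * hT

/-- Where `Λ ≠ 0`, the values of the separation variables and of `ℓ` are those of the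
functions `u₁, u₂, L` for the branch `ε √Λ` whose sign is that of `u₁`. -/
theorem Expresses.sep_eq (hb : 0 < b) (hab : b < a) (hc : ConstRel a b ℓ m h)
    (hy : IsSepPoint a b ℓ m h y) (hx : Expresses a b ℓ m h y x) {ε : ℝ}
    (hε : ε * |y.u₁| = y.u₁) (hu : y.u₁ ≠ 0) :
    y.u₁ = sepU₁ a ε x ∧ y.u₂ = sepU₂ b ε x ∧ (M a b x = m → ℓ = L a b ε x) := by
  have hD := hy.sub_pos hb hab
  have hT := Theta_mul hD.ne'
  have hT0 : 0 < Theta a b y := one_div_pos.2 hD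
  have hr := r_pos hb hab
  have hrsq := r_sq hb hab
  have ha : 0 < a := hb.trans hab
  -- The sign condition on ε makes the chosen branch of √Λ equal to r²Θu₁ itself, not to its
  -- absolute value.
  have hs : rootLam ε x = r a b ^ 2 * Theta a b y * y.u₁ := by
    rw [rootLam, hx.lam_eq hb hab hc hy, Real.sqrt_sq_eq_abs, abs_mul,
      abs_of_pos (by positivity : 0 < r a b ^ 2 * Theta a b y)]
    linear_combination r a b ^ 2 * Theta a b y * hε
  have hΔ := hx.minor_eq hb hab hc hy
  have hΔ' : b ^ 2 - minor x = r a b ^ 2 * b * y.u₁ * y.u₂ * Theta a b y := by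
    rw [hΔ]; linear_combination hrsq + r a b ^ 2 * hT
  refine ⟨?_, ?_, fun hM => ?_⟩
  · rw [sepU₁, hs, hΔ, eq_div_iff (by ring_nf; positivity)]; ring
  · rw [sepU₂, hs, hΔ', eq_div_iff (by positivity)]; ring
  · rw [L, hs, hx.omega_sq hb hab hc hy, hM, one_div_mul_eq_div, eq_div_iff (by positivity)]
    linear_combination (-m) * hΔ' + m * hΔ

end Inverse

/-! ### The separated equations -/

/-- At the time `t` the curve `y` satisfies the separated equations
`u̇ = QP`, `Q̇ = -uP`, `Ṗ = Q f'(u) / 2` in both groups of variables. -/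
structure IsSepFlowAt (a b ℓ m h : ℝ) (y : ℝ → SepPoint) (t : ℝ) : Prop where
  u₁ : HasDerivAt (fun s => (y s).u₁) ((y t).Q₁ * (y t).P₁) t
  Q₁ : HasDerivAt (fun s => (y s).Q₁) (-((y t).u₁ * (y t).P₁)) t
  P₁ : HasDerivAt (fun s => (y s).P₁)
    ((y t).Q₁ * (hStar a b m h * (y t).u₁ + a * ℓ / 2)) t
  u₂ : HasDerivAt (fun s => (y s).u₂) ((y t).Q₂ * (y t).P₂) t
  Q₂ : HasDerivAt (fun s => (y s).Q₂) (-((y t).u₂ * (y t).P₂)) t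
  P₂ : HasDerivAt (fun s => (y s).P₂) ((y t).Q₂ * (b ^ 2 * m * (y t).u₂ - b * ℓ / 2)) t

/-- The phase point expressed through the separation variables. -/
def phaseOf (a b ℓ m h : ℝ) (y : SepPoint) : Phase :=
  ofOmega (omegaOf a b ℓ m y) (alphaOf a b ℓ m h y) (betaOf a b ℓ m h y)

theorem expresses_phaseOf (a b ℓ m h : ℝ) (y : SepPoint) :
    Expresses a b ℓ m h y (phaseOf a b ℓ m h y) := by
  simp [Expresses, phaseOf]

theorem Expresses.eq_phaseOf {a b ℓ m h : ℝ} {y : SepPoint} {x : Phase}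
    (hx : Expresses a b ℓ m h y x) : x = phaseOf a b ℓ m h y := by
  rw [phaseOf, ← hx.1, ← hx.2.1, ← hx.2.2, ofOmega_eta]

/-! ### Derivatives of the coefficients of the polar form -/

section Coefficients

variable {a b ℓ m h : ℝ} {y : SepPoint}

/-- The left side is the derivative of Θ(au₁ - bu₂) along the separated flow. Together with
`alpha_im` this reads (ΘA)˙ = -i(ω₃/2)ΘA - ir²Θ²Q₁(u₁P₂ + iP₁). As e˙ = -i(ω₃/2)e, the two half
rotations add up to the term -iω₃(α₁ + iα₂) of the Euler equations, and the remainder gives iα₃w.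
`beta_re` and `beta_im` do the same for ΘB. -/
theorem alpha_re (hb : 0 < b) (hab : b < a) (hy : IsSepPoint a b ℓ m h y) :
    Theta a b y ^ 2 * (b * (y.Q₁ * y.P₁ * y.u₂ + y.u₁ * (y.Q₂ * y.P₂)))
        * (a * y.u₁ - b * y.u₂) + Theta a b y * (a * (y.Q₁ * y.P₁) - b * (y.Q₂ * y.P₂))
      = omegaOf a b ℓ m y 2 / 2 * Theta a b y * (b * y.Q₁ * y.Q₂)
        + r a b ^ 2 * Theta a b y ^ 2 * y.Q₁ * y.P₁ := by
  have hT := Theta_mul (hy.sub_pos hb hab).ne'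
  obtain ⟨hQ₁, -, hQ₂, -⟩ := hy
  rw [omegaOf_two]
  linear_combination Theta a b y ^ 2 * (a * b * (y.Q₂ * y.P₂) * hQ₁ - b ^ 2 * y.Q₁ * y.P₁ * hQ₂
      - y.Q₁ * y.P₁ * r_sq hb hab)
    - Theta a b y * (a * (y.Q₁ * y.P₁) - b * (y.Q₂ * y.P₂)) * hT

theorem alpha_im (hb : 0 < b) (hab : b < a) (hy : IsSepPoint a b ℓ m h y) :
    Theta a b y ^ 2 * (b * (y.Q₁ * y.P₁ * y.u₂ + y.u₁ * (y.Q₂ * y.P₂)))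
        * (b * y.Q₁ * y.Q₂) - Theta a b y * b * (y.u₁ * y.P₁ * y.Q₂ + y.Q₁ * (y.u₂ * y.P₂))
      = -(omegaOf a b ℓ m y 2 / 2 * Theta a b y * (a * y.u₁ - b * y.u₂)
        + r a b ^ 2 * Theta a b y ^ 2 * y.Q₁ * y.u₁ * y.P₂) := by
  have hT := Theta_mul (hy.sub_pos hb hab).ne'
  obtain ⟨hQ₁, -, hQ₂, -⟩ := hy
  rw [omegaOf_two]
  linear_combination Theta a b y ^ 2 * (b ^ 2 * y.u₂ * y.P₁ * y.Q₂ * hQ₁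
      + b ^ 2 * y.u₁ * y.Q₁ * y.P₂ * hQ₂ + y.Q₁ * y.u₁ * y.P₂ * r_sq hb hab)
    + Theta a b y * b * (y.u₁ * y.P₁ * y.Q₂ + y.Q₁ * (y.u₂ * y.P₂)) * hT

theorem beta_re (hb : 0 < b) (hab : b < a) (hy : IsSepPoint a b ℓ m h y) :
    Theta a b y ^ 2 * (b * (y.Q₁ * y.P₁ * y.u₂ + y.u₁ * (y.Q₂ * y.P₂)))
        * (b * y.u₁ - a * y.u₂) + Theta a b y * (b * (y.Q₁ * y.P₁) - a * (y.Q₂ * y.P₂))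
      = omegaOf a b ℓ m y 2 / 2 * Theta a b y * (a * y.Q₁ * y.Q₂)
        - r a b ^ 2 * Theta a b y ^ 2 * y.u₁ ^ 2 * y.Q₂ * y.P₂ := by
  have hT := Theta_mul (hy.sub_pos hb hab).ne'
  obtain ⟨hQ₁, -, hQ₂, -⟩ := hy
  rw [omegaOf_two]
  linear_combination Theta a b y ^ 2 * (a ^ 2 * (y.Q₂ * y.P₂) * hQ₁ - a * b * y.Q₁ * y.P₁ * hQ₂
      + y.u₁ ^ 2 * y.Q₂ * y.P₂ * r_sq hb hab)
    - Theta a b y * (b * (y.Q₁ * y.P₁) - a * (y.Q₂ * y.P₂)) * hT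

theorem beta_im (hb : 0 < b) (hab : b < a) (hy : IsSepPoint a b ℓ m h y) :
    Theta a b y ^ 2 * (b * (y.Q₁ * y.P₁ * y.u₂ + y.u₁ * (y.Q₂ * y.P₂)))
        * (a * y.Q₁ * y.Q₂) - Theta a b y * a * (y.u₁ * y.P₁ * y.Q₂ + y.Q₁ * (y.u₂ * y.P₂))
      = -(omegaOf a b ℓ m y 2 / 2 * Theta a b y * (b * y.u₁ - a * y.u₂)
        + r a b ^ 2 * Theta a b y ^ 2 * y.u₁ * y.Q₂ * y.P₁) := by
  have hT := Theta_mul (hy.sub_pos hb hab).ne'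
  obtain ⟨hQ₁, -, hQ₂, -⟩ := hy
  rw [omegaOf_two]
  linear_combination Theta a b y ^ 2 * (a * b * y.u₂ * y.P₁ * y.Q₂ * hQ₁
      + a * b * y.u₁ * y.Q₁ * y.P₂ * hQ₂ + y.u₁ * y.Q₂ * y.P₁ * r_sq hb hab)
    + Theta a b y * a * (y.u₁ * y.P₁ * y.Q₂ + y.Q₁ * (y.u₂ * y.P₂)) * hT

end Coefficients

namespace IsSepFlowAt

variable {a b ℓ m h t : ℝ} {y : ℝ → SepPoint}

theorem hasDerivAt_Theta (hf : IsSepFlowAt a b ℓ m h y t)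
    (hD : a - b * (y t).u₁ * (y t).u₂ ≠ 0) :
    HasDerivAt (fun s => Theta a b (y s)) (Theta a b (y t) ^ 2 *
      (b * ((y t).Q₁ * (y t).P₁ * (y t).u₂ + (y t).u₁ * ((y t).Q₂ * (y t).P₂)))) t := by
  have h₁ := (((hf.u₁.const_mul b).mul hf.u₂).const_sub a).inv hD
  refine (h₁.congr_deriv ?_).congr_of_eventuallyEq (.of_forall fun s => ?_)
  · simp only [Theta, Pi.mul_apply]; field_simp
  · simp [Theta]

theorem hasDerivAt_psi (hf : IsSepFlowAt a b ℓ m h y t) :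
    HasDerivAt (fun s => psi a b ℓ m h (y s))
      (a * b * m * ((y t).Q₂ * (y t).P₂) - hStar a b m h * ((y t).Q₁ * (y t).P₁)
        - ℓ / 2 * (b * ((y t).Q₁ * (y t).P₁ * (y t).u₂ + (y t).u₁ * ((y t).Q₂ * (y t).P₂)))) t := by
  have h₁ := ((hf.u₂.const_mul (a * b * m)).sub (hf.u₁.const_mul (hStar a b m h))).sub
    ((((hf.u₁.const_mul b).mul hf.u₂).const_add a).const_mul (ℓ / 2))
  refine h₁.congr_deriv ?_
  ring

/-- With `hasDerivAt_sinE`: the unit number e turns with angular velocity -ω₃/2. -/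
theorem hasDerivAt_cosE (hf : IsSepFlowAt a b ℓ m h y t)
    (hD : a - b * (y t).u₁ * (y t).u₂ ≠ 0) (hy : IsSepPoint a b ℓ m h (y t)) :
    HasDerivAt (fun s => cosE a b ℓ m h (y s))
      (-(omegaOf a b ℓ m (y t) 2 / 2 * sinE a b (y t))) t := by
  have hT := Theta_mul hD
  refine (((hf.hasDerivAt_Theta hD).const_mul 2).mul hf.hasDerivAt_psi).congr_deriv ?_
  obtain ⟨-, hP₁, -, hP₂⟩ := hy
  simp only [omegaOf_two, sinE]
  simp only [psi, f₁, f₂] at *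
  generalize hStar a b m h = k at *
  generalize y t = z at *
  linear_combination 2 * Theta a b z ^ 2 * (b * (z.Q₂ * z.P₂) * hP₁
    - a * (z.Q₁ * z.P₁) * hP₂)
    - 2 * Theta a b z * (a * b * m * (z.Q₂ * z.P₂) - k * (z.Q₁ * z.P₁)
        - ℓ / 2 * (b * (z.Q₁ * z.P₁ * z.u₂ + z.u₁ * (z.Q₂ * z.P₂)))) * hT

theorem hasDerivAt_sinE (hf : IsSepFlowAt a b ℓ m h y t)
    (hD : a - b * (y t).u₁ * (y t).u₂ ≠ 0) (hy : IsSepPoint a b ℓ m h (y t)) :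
    HasDerivAt (fun s => sinE a b (y s))
      (omegaOf a b ℓ m (y t) 2 / 2 * cosE a b ℓ m h (y t)) t := by
  have hT := Theta_mul hD
  refine (((hf.hasDerivAt_Theta hD).const_mul 2).mul (hf.P₁.mul hf.P₂)).congr_deriv ?_
  obtain ⟨-, hP₁, -, hP₂⟩ := hy
  simp only [omegaOf_two, cosE, Pi.mul_apply]
  simp only [psi, f₁, f₂] at *
  generalize hStar a b m h = k at *
  generalize y t = z at *
  linear_combination 2 * Theta a b z ^ 2 * b * (z.u₂ * z.Q₁ * z.P₂ * hP₁
      + z.u₁ * z.Q₂ * z.P₁ * hP₂)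
    - 2 * Theta a b z * (z.Q₁ * (k * z.u₁ + a * ℓ / 2) * z.P₂
        + z.P₁ * (z.Q₂ * (b ^ 2 * m * z.u₂ - b * ℓ / 2))) * hT

/-! ### The Euler equations for the expressed variables -/

section PhaseOf

variable (hb : 0 < b) (hab : b < a) (hc : ConstRel a b ℓ m h) (hy : IsSepPoint a b ℓ m h (y t))
  (hf : IsSepFlowAt a b ℓ m h y t)

include hb hab hy hf

theorem hasDerivAt_alphaOf_zero : HasDerivAt (fun s => alphaOf a b ℓ m h (y s) 0)
    (alphaOf a b ℓ m h (y t) 1 * omegaOf a b ℓ m (y t) 2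
      - alphaOf a b ℓ m h (y t) 2 * omegaOf a b ℓ m (y t) 1) t := by
  have hD := (hy.sub_pos hb hab).ne'
  have h₁ := (((hf.hasDerivAt_Theta hD).const_mul a).mul
    ((((hf.u₁.const_mul a).sub (hf.u₂.const_mul b)).mul (hf.hasDerivAt_cosE hD hy)).add
      (((hf.Q₁.const_mul b).mul hf.Q₂).mul (hf.hasDerivAt_sinE hD hy)))).neg
  refine (h₁.congr_deriv ?_).congr_of_eventuallyEq (.of_forall fun s => alphaOf_zero)
  rw [alphaOf_one, alphaOf_two, omegaOf_one hD hy]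
  simp only [Pi.mul_apply, Pi.add_apply, Pi.sub_apply]
  linear_combination (-(a * cosE a b ℓ m h (y t))) * alpha_re hb hab hy
    - a * sinE a b (y t) * alpha_im hb hab hy

theorem hasDerivAt_alphaOf_one : HasDerivAt (fun s => alphaOf a b ℓ m h (y s) 1)
    (alphaOf a b ℓ m h (y t) 2 * omegaOf a b ℓ m (y t) 0
      - alphaOf a b ℓ m h (y t) 0 * omegaOf a b ℓ m (y t) 2) t := by
  have hD := (hy.sub_pos hb hab).ne'
  have h₁ := ((hf.hasDerivAt_Theta hD).const_mul a).mul
    ((((hf.u₁.const_mul a).sub (hf.u₂.const_mul b)).mul (hf.hasDerivAt_sinE hD hy)).sub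
      (((hf.Q₁.const_mul b).mul hf.Q₂).mul (hf.hasDerivAt_cosE hD hy)))
  refine (h₁.congr_deriv ?_).congr_of_eventuallyEq (.of_forall fun s => alphaOf_one)
  rw [alphaOf_zero, alphaOf_two, omegaOf_zero hD hy]
  simp only [Pi.mul_apply, Pi.sub_apply]
  linear_combination a * sinE a b (y t) * alpha_re hb hab hy
    - a * cosE a b ℓ m h (y t) * alpha_im hb hab hy

theorem hasDerivAt_betaOf_zero : HasDerivAt (fun s => betaOf a b ℓ m h (y s) 0)
    (betaOf a b ℓ m h (y t) 1 * omegaOf a b ℓ m (y t) 2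
      - betaOf a b ℓ m h (y t) 2 * omegaOf a b ℓ m (y t) 1) t := by
  have hD := (hy.sub_pos hb hab).ne'
  have h₁ := ((hf.hasDerivAt_Theta hD).const_mul b).mul
    ((((hf.Q₁.const_mul a).mul hf.Q₂).mul (hf.hasDerivAt_cosE hD hy)).sub
      (((hf.u₁.const_mul b).sub (hf.u₂.const_mul a)).mul (hf.hasDerivAt_sinE hD hy)))
  refine (h₁.congr_deriv ?_).congr_of_eventuallyEq (.of_forall fun s => betaOf_zero)
  rw [betaOf_one, betaOf_two, omegaOf_one hD hy]
  simp only [Pi.mul_apply, Pi.sub_apply]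
  linear_combination b * cosE a b ℓ m h (y t) * beta_im hb hab hy
    - b * sinE a b (y t) * beta_re hb hab hy

theorem hasDerivAt_betaOf_one : HasDerivAt (fun s => betaOf a b ℓ m h (y s) 1)
    (betaOf a b ℓ m h (y t) 2 * omegaOf a b ℓ m (y t) 0
      - betaOf a b ℓ m h (y t) 0 * omegaOf a b ℓ m (y t) 2) t := by
  have hD := (hy.sub_pos hb hab).ne'
  have h₁ := (((hf.hasDerivAt_Theta hD).const_mul b).mul
    ((((hf.Q₁.const_mul a).mul hf.Q₂).mul (hf.hasDerivAt_sinE hD hy)).add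
      (((hf.u₁.const_mul b).sub (hf.u₂.const_mul a)).mul (hf.hasDerivAt_cosE hD hy)))).neg
  refine (h₁.congr_deriv ?_).congr_of_eventuallyEq (.of_forall fun s => betaOf_one)
  rw [betaOf_zero, betaOf_two, omegaOf_zero hD hy]
  simp only [Pi.mul_apply, Pi.sub_apply, Pi.add_apply]
  linear_combination (-(b * sinE a b (y t))) * beta_im hb hab hy
    - b * cosE a b ℓ m h (y t) * beta_re hb hab hy

theorem hasDerivAt_omegaOf_two : HasDerivAt (fun s => omegaOf a b ℓ m (y s) 2)
    (alphaOf a b ℓ m h (y t) 1 - betaOf a b ℓ m h (y t) 0) t := by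
  have hD := (hy.sub_pos hb hab).ne'
  have hT := Theta_mul hD
  have h₁ := ((hf.hasDerivAt_Theta hD).const_mul 2).mul
    (((hf.Q₂.const_mul b).mul hf.P₁).sub ((hf.Q₁.const_mul a).mul hf.P₂))
  refine h₁.congr_deriv ?_
  obtain ⟨hQ₁, hP₁, hQ₂, hP₂⟩ := hy
  rw [alphaOf_one, betaOf_zero]
  simp only [Pi.mul_apply, Pi.sub_apply, cosE, sinE]
  simp only [psi, f₁, f₂] at *
  generalize hStar a b m h = k at *
  generalize y t = z at *
  generalize Theta a b z = T at *
  linear_combination 2 * T ^ 2 * b ^ 2 * z.u₂ * z.Q₁ * z.Q₂ * hP₁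
    - 2 * T ^ 2 * a * b * z.u₁ * z.Q₁ * z.Q₂ * hP₂
    - 2 * T ^ 2 * a * b * z.u₂ * z.P₁ * z.P₂ * hQ₁ + 2 * T ^ 2 * b ^ 2 * z.u₁ * z.P₁ * z.P₂ * hQ₂
    - 2 * T * (-(b * z.u₂ * z.P₂ * z.P₁) + b * z.Q₂ * z.Q₁ * (k * z.u₁ + a * ℓ / 2)
      + a * z.u₁ * z.P₁ * z.P₂ - a * z.Q₁ * z.Q₂ * (b ^ 2 * m * z.u₂ - b * ℓ / 2)) * hT

include hc

theorem hasDerivAt_alphaOf_two : HasDerivAt (fun s => alphaOf a b ℓ m h (y s) 2)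
    (alphaOf a b ℓ m h (y t) 0 * omegaOf a b ℓ m (y t) 1
      - alphaOf a b ℓ m h (y t) 1 * omegaOf a b ℓ m (y t) 0) t := by
  have hD := (hy.sub_pos hb hab).ne'
  have hT := Theta_mul hD
  have hE := cosE_sq_add_sinE_sq hD hc hy
  refine (((hf.hasDerivAt_Theta hD).const_mul (a * r a b)).mul hf.Q₁).congr_deriv ?_
  rw [alphaOf_zero, alphaOf_one, omegaOf_zero hD hy, omegaOf_one hD hy]
  obtain ⟨hQ₁, -, -, -⟩ := hy
  linear_combination a * r a b * Theta a b (y t) ^ 2 * (((a * (y t).u₁ - b * (y t).u₂) * (y t).P₁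
      - b * (y t).Q₁ * (y t).Q₂ * (y t).u₁ * (y t).P₂) * hE + b * (y t).u₂ * (y t).P₁ * hQ₁)
    + a * r a b * Theta a b (y t) * (y t).u₁ * (y t).P₁ * hT

theorem hasDerivAt_betaOf_two : HasDerivAt (fun s => betaOf a b ℓ m h (y s) 2)
    (betaOf a b ℓ m h (y t) 0 * omegaOf a b ℓ m (y t) 1
      - betaOf a b ℓ m h (y t) 1 * omegaOf a b ℓ m (y t) 0) t := by
  have hD := (hy.sub_pos hb hab).ne'
  have hT := Theta_mul hD
  have hE := cosE_sq_add_sinE_sq hD hc hy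
  refine ((((hf.hasDerivAt_Theta hD).const_mul (b * r a b)).mul hf.u₁).mul hf.Q₂).congr_deriv ?_
  rw [betaOf_zero, betaOf_one, omegaOf_zero hD hy, omegaOf_one hD hy]
  obtain ⟨-, -, hQ₂, -⟩ := hy
  simp only [Pi.mul_apply]
  linear_combination b * r a b * Theta a b (y t) ^ 2 * (b * (y t).u₁ ^ 2 * (y t).P₂ * hQ₂
      - (a * (y t).Q₁ * (y t).Q₂ * (y t).P₁
        + (b * (y t).u₁ - a * (y t).u₂) * (y t).u₁ * (y t).P₂) * hE)
    - b * r a b * Theta a b (y t) * ((y t).Q₁ * (y t).P₁ * (y t).Q₂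
      - (y t).u₁ * (y t).u₂ * (y t).P₂) * hT

theorem hasDerivAt_omegaOf_zero : HasDerivAt (fun s => omegaOf a b ℓ m (y s) 0)
    ((omegaOf a b ℓ m (y t) 1 * omegaOf a b ℓ m (y t) 2 + betaOf a b ℓ m h (y t) 2) / 2) t := by
  have hD := (hy.sub_pos hb hab).ne'
  have hT := Theta_mul hD
  have h₁ := ((((hf.u₁.const_mul ℓ).sub_const (2 * a * m)).const_mul (r a b)).mul
    (hf.hasDerivAt_Theta hD)).mul hf.P₂
  refine h₁.congr_deriv ?_
  obtain ⟨-, hP₁, -, hP₂⟩ := hy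
  rw [constRel_iff] at hc
  simp only [Pi.mul_apply, omegaOf, betaOf, Matrix.cons_val]
  simp only [f₁, f₂] at *
  generalize hStar a b m h = k at *
  generalize y t = z at *
  generalize Theta a b z = T at *
  linear_combination (-(r a b * T * (ℓ * z.Q₁ * z.P₁ * z.P₂
      + (ℓ * z.u₁ - 2 * a * m) * z.Q₂ * (b ^ 2 * m * z.u₂ - b * ℓ / 2)))
      + r a b * b * T * z.u₁ * z.Q₂ / 2) * hT
    - r a b * (2 * b * m * z.u₂ - ℓ) * T ^ 2 * b * z.Q₂ * hP₁
    + r a b * (ℓ * z.u₁ - 2 * a * m) * T ^ 2 * b * z.u₁ * z.Q₂ * hP₂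
    + r a b * T ^ 2 * b * z.Q₂ * z.u₁ * (a - b * z.u₁ * z.u₂) / 2 * hc

theorem hasDerivAt_omegaOf_one : HasDerivAt (fun s => omegaOf a b ℓ m (y s) 1)
    (-(omegaOf a b ℓ m (y t) 0 * omegaOf a b ℓ m (y t) 2 + alphaOf a b ℓ m h (y t) 2) / 2) t := by
  have hD := (hy.sub_pos hb hab).ne'
  have hT := Theta_mul hD
  have h₁ := ((((hf.u₂.const_mul (2 * b * m)).sub_const ℓ).const_mul (r a b)).mul
    (hf.hasDerivAt_Theta hD)).mul hf.P₁
  refine h₁.congr_deriv ?_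
  obtain ⟨-, hP₁, -, hP₂⟩ := hy
  rw [constRel_iff] at hc
  simp only [Pi.mul_apply, omegaOf, alphaOf, Matrix.cons_val]
  simp only [f₁, f₂] at *
  generalize hStar a b m h = k at *
  generalize y t = z at *
  generalize Theta a b z = T at *
  linear_combination (-(r a b * T * (2 * b * m * z.Q₂ * z.P₂ * z.P₁
      + (2 * b * m * z.u₂ - ℓ) * z.Q₁ * (k * z.u₁ + a * ℓ / 2)))
      - r a b * a * T * z.Q₁ / 2) * hT
    - r a b * (ℓ * z.u₁ - 2 * a * m) * T ^ 2 * a * z.Q₁ * hP₂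
    + r a b * (2 * b * m * z.u₂ - ℓ) * T ^ 2 * b * z.u₂ * z.Q₁ * hP₁
    - r a b * T ^ 2 * a * z.Q₁ * (a - b * z.u₁ * z.u₂) / 2 * hc

/-- A solution of the separated equations yields a solution of the Euler equations. -/
theorem hasDerivAt_phaseOf : HasDerivAt (fun s => phaseOf a b ℓ m h (y s))
    (eulerField H (phaseOf a b ℓ m h (y t))) t := by
  have hω : ∀ i, HasDerivAt (fun s => omegaOf a b ℓ m (y s) i)
      (omega (eulerField H (phaseOf a b ℓ m h (y t))) i) t := by
    rw [eulerField_H, omega_ofOmega]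
    simp only [phaseOf, omega_ofOmega, alpha_ofOmega, beta_ofOmega]
    intro i
    fin_cases i
    exacts [hasDerivAt_omegaOf_zero hb hab hc hy hf, hasDerivAt_omegaOf_one hb hab hc hy hf,
      hasDerivAt_omegaOf_two hb hab hy hf]
  have hα : ∀ i, HasDerivAt (fun s => alphaOf a b ℓ m h (y s) i)
      (alpha (eulerField H (phaseOf a b ℓ m h (y t))) i) t := by
    rw [eulerField_H, alpha_ofOmega]
    simp only [phaseOf, omega_ofOmega, alpha_ofOmega]
    intro i
    fin_cases i
    exacts [hasDerivAt_alphaOf_zero hb hab hy hf, hasDerivAt_alphaOf_one hb hab hy hf,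
      hasDerivAt_alphaOf_two hb hab hc hy hf]
  have hβ : ∀ i, HasDerivAt (fun s => betaOf a b ℓ m h (y s) i)
      (beta (eulerField H (phaseOf a b ℓ m h (y t))) i) t := by
    rw [eulerField_H, beta_ofOmega]
    simp only [phaseOf, omega_ofOmega, beta_ofOmega]
    intro i
    fin_cases i
    exacts [hasDerivAt_betaOf_zero hb hab hy hf, hasDerivAt_betaOf_one hb hab hy hf,
      hasDerivAt_betaOf_two hb hab hc hy hf]
  rw [← ofOmega_eta (eulerField H (phaseOf a b ℓ m h (y t)))]
  exact (hasDerivAt_pi.2 fun i => (hω i).const_mul (inertia i)).prodMk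
    ((hasDerivAt_pi.2 hα).prodMk (hasDerivAt_pi.2 hβ))

end PhaseOf

end IsSepFlowAt

/-! ### The leaf and the critical subsystem -/

section Leaf

variable {a b : ℝ} {x : Phase}

theorem leaf_third_sq (hx : x ∈ leaf a b) :
    alpha x 2 ^ 2 + beta x 2 ^ 2 = a ^ 2 + b ^ 2 - 2 * minor x - Lam x := by
  obtain ⟨h₁, h₂, -⟩ := hx
  rw [dot_eq] at h₁ h₂
  rw [minor, Lam]
  linear_combination h₁ + h₂

/-- For an orthogonal frame α, β, α × β with lengths a, b, ab, this is the unit length of the third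
column of the normalized matrix. With `leaf_third_sq` it determines α₃² and β₃² from Λ and the
minor. -/
theorem leaf_gram (hx : x ∈ leaf a b) :
    b ^ 2 * alpha x 2 ^ 2 + a ^ 2 * beta x 2 ^ 2 = a ^ 2 * b ^ 2 - minor x ^ 2 := by
  obtain ⟨h₁, h₂, h₃⟩ := hx
  rw [dot_eq] at h₁ h₂ h₃
  rw [minor, ← h₁, ← h₂]
  linear_combination (-(alpha x 0 * beta x 0 + alpha x 1 * beta x 1 + alpha x 2 * beta x 2)
    + 2 * alpha x 2 * beta x 2) * h₃

theorem leaf_alpha_sq (hx : x ∈ leaf a b) :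
    (a ^ 2 - b ^ 2) * alpha x 2 ^ 2 = (a ^ 2 - minor x) ^ 2 - a ^ 2 * Lam x := by
  linear_combination a ^ 2 * leaf_third_sq hx - leaf_gram hx

theorem leaf_beta_sq (hx : x ∈ leaf a b) :
    (a ^ 2 - b ^ 2) * beta x 2 ^ 2 = b ^ 2 * Lam x - (b ^ 2 - minor x) ^ 2 := by
  linear_combination leaf_gram hx - b ^ 2 * leaf_third_sq hx

theorem leaf_minor_lt (hb : 0 < b) (hab : b < a) (hx : x ∈ leaf a b) : 0 < a ^ 2 - minor x := by
  have h := leaf_gram hx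
  have h₁ : minor x ^ 2 ≤ (a * b) ^ 2 := by
    nlinarith [mul_nonneg (sq_nonneg b) (sq_nonneg (alpha x 2)),
      mul_nonneg (sq_nonneg a) (sq_nonneg (beta x 2))]
  have h₂ := abs_le_of_sq_le_sq h₁ (by nlinarith)
  nlinarith [(le_abs_self _).trans h₂]

/-- Minus the derivative of `2G - p²H` in `ω₃`. -/
def critOmega (x : Phase) : ℝ :=
  Lam x * omega x 2
    - 2 * (omega x 0 * ((alpha x 0 - beta x 1) * alpha x 2 + (alpha x 1 + beta x 0) * beta x 2)
      + omega x 1 * ((alpha x 1 + beta x 0) * alpha x 2 - (alpha x 0 - beta x 1) * beta x 2))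

theorem leaf_critOmega_sq (hx : x ∈ leaf a b) :
    2 * Lam x * (2 * G x - (a ^ 2 + b ^ 2) * H x) + critOmega x ^ 2 =
      2 * (a ^ 2 - b ^ 2) *
        (((alpha x 0 - beta x 1) ^ 2 - (alpha x 1 + beta x 0) ^ 2)
            * (omega x 0 ^ 2 - omega x 1 ^ 2 + alpha x 0 - beta x 1)
          + 2 * (alpha x 0 - beta x 1) * (alpha x 1 + beta x 0)
            * (2 * omega x 0 * omega x 1 + alpha x 1 + beta x 0)) := by
  obtain ⟨h₁, h₂, h₃⟩ := hx
  rw [← h₁, ← h₂]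
  rw [dot_eq] at h₃
  simp only [G, H, critOmega, Lam, dot_eq]
  linear_combination (4 * ((alpha x 0 - beta x 1) ^ 2 + (alpha x 1 + beta x 0) ^ 2)
      * (alpha x 1 + beta x 0)
    - 4 * (((alpha x 0 - beta x 1) ^ 2 - (alpha x 1 + beta x 0) ^ 2) * (2 * omega x 0 * omega x 1)
      - 2 * (alpha x 0 - beta x 1) * (alpha x 1 + beta x 0)
        * (omega x 0 ^ 2 - omega x 1 ^ 2))) * h₃

theorem isTangent_ofOmega (w : Fin 3 → ℝ) : IsTangent x (ofOmega w 0 0) := by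
  simp [IsTangent]

theorem N_critOmega (hb : 0 < b) (hab : b < a) (hx : x ∈ N a b) : critOmega x = 0 := by
  obtain ⟨hl, hF, hd⟩ := hx
  have hr := r_pos hb hab
  -- The direction of ω₃: it is tangent to the leaf and does not change K.
  have h₁ := hd _ (isTangent_ofOmega ![0, 0, 1])
  rw [fderiv_F] at h₁
  have h₂ : dK x (ofOmega ![0, 0, 1] 0 0) = 0 := by simp [dK]
  have h₃ : 2 * dG x (ofOmega ![0, 0, 1] 0 0) - p a b ^ 2 * dH x (ofOmega ![0, 0, 1] 0 0)
      = -critOmega x := by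
    obtain ⟨e₁, e₂, -⟩ := hl
    rw [p_sq, ← e₁, ← e₂]
    simp only [dG, dH, omega_ofOmega, alpha_ofOmega, beta_ofOmega, Matrix.cons_val, dot_eq,
      Pi.zero_apply, critOmega, Lam]
    ring
  rw [h₂, h₃] at h₁
  have h₄ : (2 * G x - p a b ^ 2 * H x) * critOmega x = 0 := by linear_combination -h₁ / 2
  rcases mul_eq_zero.1 h₄ with hc | hc
  -- If 2G - p²H = 0, then F = 0 gives K = 0, so w² + x₁ = 0 and `leaf_critOmega_sq` reduces to c² =
  -- 0.
  · have hK : K x = 0 := by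
      have : r a b ^ 4 * K x = 0 := by
        rw [F, hc] at hF; linear_combination -hF
      exact (mul_eq_zero.1 this).resolve_left (by positivity)
    rw [K] at hK
    have k₁ : omega x 0 ^ 2 - omega x 1 ^ 2 + alpha x 0 - beta x 1 = 0 := by
      rw [← sq_eq_zero_iff]; nlinarith
    have k₂ : 2 * omega x 0 * omega x 1 + alpha x 1 + beta x 0 = 0 := by
      rw [← sq_eq_zero_iff]; nlinarith
    have h₅ := leaf_critOmega_sq hl
    rw [← p_sq, hc, k₁, k₂] at h₅
    rw [← sq_eq_zero_iff]; linear_combination h₅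
  · exact hc

theorem J_two_G (hb : 0 < b) (hab : b < a) {m h : ℝ} (hx : x ∈ J a b m h) :
    2 * G x - p a b ^ 2 * H x = r a b ^ 4 * m := by
  have hr := r_pos hb hab
  rw [← hx.2.1, M]; field_simp

theorem J_K (hb : 0 < b) (hab : b < a) {m h : ℝ} (hx : x ∈ J a b m h) :
    K x = r a b ^ 4 * m ^ 2 := by
  have hr := r_pos hb hab
  have hF := hx.1.2.1
  rw [F, J_two_G hb hab hx] at hF
  have : r a b ^ 4 * (r a b ^ 4 * m ^ 2 - K x) = 0 := by linear_combination hF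
  linear_combination -(mul_eq_zero.1 this).resolve_left (by positivity)

/-- On `J`, the number `w² + x₁` is a real multiple of `x₁²`, where `w = ω₁ + iω₂` and
`x₁ = (α₁ - β₂) + i(α₂ + β₁)`. -/
theorem J_kappa (hb : 0 < b) (hab : b < a) {m h : ℝ} (hx : x ∈ J a b m h) (hL : Lam x ≠ 0) :
    Lam x * (omega x 0 ^ 2 - omega x 1 ^ 2 + alpha x 0 - beta x 1)
        = r a b ^ 2 * m * ((alpha x 0 - beta x 1) ^ 2 - (alpha x 1 + beta x 0) ^ 2) ∧
      Lam x * (2 * omega x 0 * omega x 1 + alpha x 1 + beta x 0)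
        = r a b ^ 2 * m * (2 * (alpha x 0 - beta x 1) * (alpha x 1 + beta x 0)) := by
  have hr := r_pos hb hab
  have h₁ := leaf_critOmega_sq hx.1.1
  rw [N_critOmega hb hab hx.1, ← p_sq, J_two_G hb hab hx, ← r_sq hb hab] at h₁
  have hK := J_K hb hab hx
  rw [K] at hK
  have hΛ : Lam x = (alpha x 0 - beta x 1) ^ 2 + (alpha x 1 + beta x 0) ^ 2 := rfl
  generalize omega x 0 ^ 2 - omega x 1 ^ 2 + alpha x 0 - beta x 1 = k₁ at *
  generalize 2 * omega x 0 * omega x 1 + alpha x 1 + beta x 0 = k₂ at *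
  generalize alpha x 0 - beta x 1 = X at *
  generalize alpha x 1 + beta x 0 = Y at *
  generalize Lam x = Λ at *
  generalize r a b = ρ at *
  have hre : (X ^ 2 - Y ^ 2) * k₁ + 2 * X * Y * k₂ = Λ * ρ ^ 2 * m := by
    have : ρ ^ 2 * ((X ^ 2 - Y ^ 2) * k₁ + 2 * X * Y * k₂ - Λ * ρ ^ 2 * m) = 0 := by
      linear_combination -h₁ / 2
    linear_combination (mul_eq_zero.1 this).resolve_left (by positivity)
  -- The squares of the real and imaginary parts of x̄₁²(w² + x₁) sum to Λ²K = (Λr²m)², and `hre`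
  -- shows that the real part already accounts for all of it.
  have him : (X ^ 2 - Y ^ 2) * k₂ - 2 * X * Y * k₁ = 0 := by
    rw [← sq_eq_zero_iff]
    linear_combination (X ^ 2 + Y ^ 2) ^ 2 * hK - (Λ + X ^ 2 + Y ^ 2) * ρ ^ 4 * m ^ 2 * hΛ
      - ((X ^ 2 - Y ^ 2) * k₁ + 2 * X * Y * k₂ + Λ * ρ ^ 2 * m) * hre
  constructor
  · apply mul_left_cancel₀ hL
    linear_combination (X ^ 2 - Y ^ 2) * hre - 2 * X * Y * him
      + (Λ + X ^ 2 + Y ^ 2) * k₁ * hΛ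
  · apply mul_left_cancel₀ hL
    linear_combination (2 * X * Y) * hre + (X ^ 2 - Y ^ 2) * him
      + (Λ + X ^ 2 + Y ^ 2) * k₂ * hΛ

end Leaf

/-! ### The separation variables where `Λ ≠ 0` -/

section Regular

variable {a b m h : ℝ} {x : Phase}

/-- The real and imaginary parts of (α₁ + iα₂)x̄₁; `leaf_beta_mul` gives those of (β₂ + iβ₁)x₁. They
recover the horizontal components from x₁, the minor and z. -/
theorem leaf_alpha_mul (hx : x ∈ leaf a b) :
    alpha x 0 * (alpha x 0 - beta x 1) + alpha x 1 * (alpha x 1 + beta x 0)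
        = a ^ 2 - minor x - alpha x 2 ^ 2 ∧
      alpha x 1 * (alpha x 0 - beta x 1) - alpha x 0 * (alpha x 1 + beta x 0)
        = alpha x 2 * beta x 2 := by
  obtain ⟨h₁, -, h₃⟩ := hx
  rw [dot_eq] at h₁ h₃
  rw [minor]
  exact ⟨by linear_combination h₁, by linear_combination -h₃⟩

theorem leaf_beta_mul (hx : x ∈ leaf a b) :
    beta x 1 * (alpha x 0 - beta x 1) - beta x 0 * (alpha x 1 + beta x 0)
        = -(b ^ 2 - minor x - beta x 2 ^ 2) ∧
      beta x 0 * (alpha x 0 - beta x 1) + beta x 1 * (alpha x 1 + beta x 0)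
        = -(alpha x 2 * beta x 2) := by
  obtain ⟨-, h₂, h₃⟩ := hx
  rw [dot_eq] at h₂ h₃
  rw [minor]
  exact ⟨by linear_combination -h₂, by linear_combination h₃⟩

/-- The values of the separation variables and of the radicals at a point with `Λ ≠ 0`. -/
def sepPointOf (a b ε : ℝ) (x : Phase) : SepPoint where
  u₁ := sepU₁ a ε x
  Q₁ := r a b * alpha x 2 / (a ^ 2 - minor x)
  P₁ := a * r a b * (omega x 0 * (alpha x 1 + beta x 0) - omega x 1 * (alpha x 0 - beta x 1))
    / (rootLam ε x * (a ^ 2 - minor x))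
  u₂ := sepU₂ b ε x
  Q₂ := r a b * beta x 2 / (b * rootLam ε x)
  P₂ := -(r a b * (omega x 0 * (alpha x 0 - beta x 1) + omega x 1 * (alpha x 1 + beta x 0)))
    / rootLam ε x ^ 2

variable {ε : ℝ}

theorem rootLam_sq (hε : ε = 1 ∨ ε = -1) : rootLam ε x ^ 2 = Lam x := by
  have h₁ : 0 ≤ Lam x := by unfold Lam; positivity
  rcases hε with rfl | rfl <;> simp [rootLam, Real.sq_sqrt h₁]

theorem rootLam_ne_zero (hε : ε = 1 ∨ ε = -1) (hL : Lam x ≠ 0) : rootLam ε x ≠ 0 := fun h₁ =>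
  hL (by rw [← rootLam_sq hε, h₁]; ring)

theorem L_mul_rootLam (hx : x ∈ J a b m h) (hε : ε = 1 ∨ ε = -1) (hL : Lam x ≠ 0) :
    L a b ε x * rootLam ε x =
      omega x 0 ^ 2 + omega x 1 ^ 2 + (a ^ 2 + b ^ 2 - 2 * minor x) * m := by
  have := rootLam_ne_zero hε hL
  rw [L, hx.2.1]; field_simp

/-- The real and imaginary parts of (x̄₁w)² = Λ(r²m - x̄₁), which is `J_kappa` multiplied by x̄₁².
-/
theorem J_omega_sq (hb : 0 < b) (hab : b < a) (hx : x ∈ J a b m h) (hL : Lam x ≠ 0) :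
    ((alpha x 0 - beta x 1) ^ 2 - (alpha x 1 + beta x 0) ^ 2) * (omega x 0 ^ 2 - omega x 1 ^ 2)
        + 4 * (alpha x 0 - beta x 1) * (alpha x 1 + beta x 0) * omega x 0 * omega x 1
        = Lam x * (r a b ^ 2 * m - (alpha x 0 - beta x 1)) ∧
      ((alpha x 0 - beta x 1) ^ 2 - (alpha x 1 + beta x 0) ^ 2) * (2 * omega x 0 * omega x 1)
        - 2 * (alpha x 0 - beta x 1) * (alpha x 1 + beta x 0) * (omega x 0 ^ 2 - omega x 1 ^ 2)
        = Lam x * (alpha x 1 + beta x 0) := by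
  obtain ⟨k₁, k₂⟩ := J_kappa hb hab hx hL
  have hΛ : Lam x = (alpha x 0 - beta x 1) ^ 2 + (alpha x 1 + beta x 0) ^ 2 := rfl
  rw [add_sub_assoc] at k₁
  rw [add_assoc _ (alpha x 1)] at k₂
  generalize alpha x 0 - beta x 1 = X at *
  generalize alpha x 1 + beta x 0 = Y at *
  generalize Lam x = Λ at *
  constructor
  · apply mul_left_cancel₀ hL
    linear_combination (X ^ 2 - Y ^ 2) * k₁ + 2 * X * Y * k₂
      + (-(Λ + X ^ 2 + Y ^ 2) * r a b ^ 2 * m + X * Λ) * hΛ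
  · apply mul_left_cancel₀ hL
    linear_combination (X ^ 2 - Y ^ 2) * k₂ - 2 * X * Y * k₁ - Y * Λ * hΛ

theorem J_H_mul_lam (hb : 0 < b) (hab : b < a) (hx : x ∈ J a b m h) (hL : Lam x ≠ 0) :
    h * Lam x = (a ^ 2 + b ^ 2 - 2 * minor x) * (omega x 0 ^ 2 + omega x 1 ^ 2)
      + m * ((a ^ 2 - minor x) ^ 2 + (b ^ 2 - minor x) ^ 2 - (a ^ 2 + b ^ 2) * Lam x)
      - r a b ^ 2 * (alpha x 0 - beta x 1) := by
  obtain ⟨hre, him⟩ := J_omega_sq hb hab hx hL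
  have hl := hx.1.1
  have hz := leaf_third_sq hl
  have hα := leaf_alpha_sq hl
  have hβ := leaf_beta_sq hl
  have hR := r_sq hb hab
  have hΛ : Lam x = (alpha x 0 - beta x 1) ^ 2 + (alpha x 1 + beta x 0) ^ 2 := rfl
  have hF := N_critOmega hb hab hx.1
  rw [critOmega] at hF
  have hH : H x = h := hx.2.2
  rw [H] at hH
  obtain ⟨e₁, e₂, e₃⟩ := hl
  rw [dot_eq] at e₁ e₂ e₃
  -- Square Λω₃ = 2 Re(x̄₁wz) by 2(Re ζ)² = |ζ|² + Re ζ² and insert the value of (x̄₁w)².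
  have hω : Lam x * omega x 2 ^ 2 = 2 * ((alpha x 2 ^ 2 + beta x 2 ^ 2)
        * (omega x 0 ^ 2 + omega x 1 ^ 2)
      + (alpha x 2 ^ 2 - beta x 2 ^ 2) * (r a b ^ 2 * m - (alpha x 0 - beta x 1))
      - 2 * alpha x 2 * beta x 2 * (alpha x 1 + beta x 0)) := by
    apply mul_left_cancel₀ hL
    generalize alpha x 0 - beta x 1 = X at *
    generalize alpha x 1 + beta x 0 = Y at *
    linear_combination (Lam x * omega x 2 + 2 * (omega x 0 * (X * alpha x 2 + Y * beta x 2)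
        + omega x 1 * (Y * alpha x 2 - X * beta x 2))) * hF
      - 2 * (alpha x 2 ^ 2 + beta x 2 ^ 2) * (omega x 0 ^ 2 + omega x 1 ^ 2) * hΛ
      + 2 * (alpha x 2 ^ 2 - beta x 2 ^ 2) * hre - 4 * alpha x 2 * beta x 2 * him
  -- The left side is -Re(z²x̄₁); the leaf equations eliminate z² = α₃² - β₃² + 2iα₃β₃.
  have hU : -(alpha x 2 ^ 2 - beta x 2 ^ 2) * (alpha x 0 - beta x 1)
      - 2 * alpha x 2 * beta x 2 * (alpha x 1 + beta x 0)
      = -(r a b ^ 2) * (alpha x 0 - beta x 1) + Lam x * (alpha x 0 + beta x 1) := by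
    rw [hR, hΛ]
    linear_combination (alpha x 0 - beta x 1) * (e₂ - e₁) - 2 * (alpha x 1 + beta x 0) * e₃
  linear_combination (-Lam x) * hH + hω / 2 + hU + m * (alpha x 2 ^ 2 - beta x 2 ^ 2) * hR
    + m * (hα - hβ) + (omega x 0 ^ 2 + omega x 1 ^ 2) * hz

/-- The linear relation between `α₁ - β₂` and the integral constants. -/
theorem J_sub_eq (hb : 0 < b) (hab : b < a) (hx : x ∈ J a b m h) (hL : Lam x ≠ 0)
    (hε : ε = 1 ∨ ε = -1) :
    r a b ^ 2 * (alpha x 0 - beta x 1) =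
      (a ^ 2 + b ^ 2 - 2 * minor x) * (L a b ε x * rootLam ε x)
        - 2 * m * (a ^ 2 - minor x) * (b ^ 2 - minor x) + 2 * hStar a b m h * rootLam ε x ^ 2 := by
  have h₁ := J_H_mul_lam hb hab hx hL
  have hℓ := L_mul_rootLam hx hε hL
  have hp := p_sq a b
  rw [rootLam_sq hε, hStar]
  linear_combination h₁ - (a ^ 2 + b ^ 2 - 2 * minor x) * hℓ + Lam x * m * hp

theorem J_constRel (hb : 0 < b) (hab : b < a) (hx : x ∈ J a b m h) (hL : Lam x ≠ 0)
    (hε : ε = 1 ∨ ε = -1) : ConstRel a b (L a b ε x) m h := by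
  have hs := rootLam_ne_zero hε hL
  have h₁ := J_sub_eq hb hab hx hL hε
  have hℓ := L_mul_rootLam hx hε hL
  have hK := J_K hb hab hx
  have hsq := rootLam_sq (x := x) hε
  obtain ⟨k₁, k₂⟩ := J_kappa hb hab hx hL
  rw [← hsq] at k₁ k₂
  rw [constRel_iff]
  -- This is |w|⁴ = |(w² + x₁) - x₁|², expanded with K = r⁴m² and the direction of w² + x₁ from
  -- `J_kappa`. Eliminating α₁ - β₂ by `J_sub_eq` then leaves the relation between the constants.
  have hW : (omega x 0 ^ 2 + omega x 1 ^ 2) ^ 2 = r a b ^ 4 * m ^ 2 + rootLam ε x ^ 2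
      - 2 * r a b ^ 2 * m * (alpha x 0 - beta x 1) := by
    rw [K] at hK
    apply mul_left_cancel₀ (pow_ne_zero 2 hs)
    have hΛ : rootLam ε x ^ 2 = (alpha x 0 - beta x 1) ^ 2 + (alpha x 1 + beta x 0) ^ 2 := hsq
    linear_combination rootLam ε x ^ 2 * hK - 2 * (alpha x 0 - beta x 1) * k₁
      - 2 * (alpha x 1 + beta x 0) * k₂
      + (-rootLam ε x ^ 2 + 2 * r a b ^ 2 * m * (alpha x 0 - beta x 1)) * hΛ
  apply mul_left_cancel₀ (pow_ne_zero 2 hs)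
  have hR := r_sq hb hab
  linear_combination (L a b ε x * rootLam ε x + omega x 0 ^ 2 + omega x 1 ^ 2
    - (a ^ 2 + b ^ 2 - 2 * minor x) * m) * hℓ + hW - 2 * m * h₁
    + m ^ 2 * (r a b ^ 2 + a ^ 2 - b ^ 2) * hR

/-- The squares of the imaginary and real parts of x̄₁w, from (|ζ|² ∓ Re ζ²)/2, followed by twice
the product of the two parts. After division the first two are the radicands of P₁ and P₂; the third
fixes the relative sign of these radicals through `sinE`. -/
theorem J_products (hb : 0 < b) (hab : b < a) (hx : x ∈ J a b m h) (hL : Lam x ≠ 0)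
    (hε : ε = 1 ∨ ε = -1) :
    r a b ^ 2 * (omega x 0 * (alpha x 1 + beta x 0) - omega x 1 * (alpha x 0 - beta x 1)) ^ 2 =
        rootLam ε x ^ 2 * (hStar a b m h * rootLam ε x ^ 2
          + L a b ε x * rootLam ε x * (a ^ 2 - minor x) - m * (a ^ 2 - minor x) ^ 2) ∧
      r a b ^ 2 * (omega x 0 * (alpha x 0 - beta x 1) + omega x 1 * (alpha x 1 + beta x 0)) ^ 2 =
        rootLam ε x ^ 2 * (m * (b ^ 2 - minor x) ^ 2
          - L a b ε x * rootLam ε x * (b ^ 2 - minor x) - hStar a b m h * rootLam ε x ^ 2) ∧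
      -2 * ((omega x 0 * (alpha x 1 + beta x 0) - omega x 1 * (alpha x 0 - beta x 1))
        * (omega x 0 * (alpha x 0 - beta x 1) + omega x 1 * (alpha x 1 + beta x 0))) =
        rootLam ε x ^ 2 * (alpha x 1 + beta x 0) := by
  have hs := rootLam_ne_zero hε hL
  have h₁ := J_sub_eq hb hab hx hL hε
  have hℓ := L_mul_rootLam hx hε hL
  have hsq := rootLam_sq (x := x) hε
  have hR := r_sq hb hab
  obtain ⟨hre, him⟩ := J_omega_sq hb hab hx hL
  have hΛ : rootLam ε x ^ 2 = (alpha x 0 - beta x 1) ^ 2 + (alpha x 1 + beta x 0) ^ 2 := hsq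
  rw [← hsq] at hre him
  generalize alpha x 0 - beta x 1 = X at *
  generalize alpha x 1 + beta x 0 = Y at *
  generalize L a b ε x = ℓ at *
  generalize rootLam ε x = s at *
  generalize hStar a b m h = k at *
  generalize omega x 0 = w₁ at *
  generalize omega x 1 = w₂ at *
  generalize minor x = Δ at *
  generalize r a b = ρ at *
  refine ⟨?_, ?_, ?_⟩
  · linear_combination (-ρ ^ 2 / 2) * hre - ρ ^ 2 / 2 * (w₁ ^ 2 + w₂ ^ 2) * hΛ
      - ρ ^ 2 / 2 * s ^ 2 * hℓ + s ^ 2 / 2 * h₁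
      + s ^ 2 / 2 * (s * ℓ - m * (a ^ 2 + b ^ 2 - 2 * Δ) - m * (ρ ^ 2 + a ^ 2 - b ^ 2)) * hR
  · linear_combination (ρ ^ 2 / 2) * hre - ρ ^ 2 / 2 * (w₁ ^ 2 + w₂ ^ 2) * hΛ
      - ρ ^ 2 / 2 * s ^ 2 * hℓ - s ^ 2 / 2 * h₁
      + s ^ 2 / 2 * (s * ℓ - m * (a ^ 2 + b ^ 2 - 2 * Δ) + m * (ρ ^ 2 + a ^ 2 - b ^ 2)) * hR
  · linear_combination him

section SepPointOf

variable (hb : 0 < b) (hab : b < a) (hx : x ∈ J a b m h) (hL : Lam x ≠ 0) (hε : ε = 1 ∨ ε = -1)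

include hb hab hx hL hε

theorem Theta_sepPointOf :
    Theta a b (sepPointOf a b ε x) = (a ^ 2 - minor x) / (a * r a b ^ 2) := by
  have hs := rootLam_ne_zero hε hL
  have hA := leaf_minor_lt hb hab hx.1.1
  have ha : 0 < a := hb.trans hab
  have hr := r_pos hb hab
  rw [Theta, sepPointOf]
  simp only [sepU₁, sepU₂]
  rw [one_div, inv_eq_iff_eq_inv, inv_div]
  field_simp
  linear_combination -r_sq hb hab

theorem isSepPoint_sepPointOf : IsSepPoint a b (L a b ε x) m h (sepPointOf a b ε x) := by
  have hs := rootLam_ne_zero hε hL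
  have hA := leaf_minor_lt hb hab hx.1.1
  have hsq := rootLam_sq (x := x) hε
  have hR := r_sq hb hab
  obtain ⟨h₁, h₂, -⟩ := J_products hb hab hx hL hε
  have hα := leaf_alpha_sq hx.1.1
  have hβ := leaf_beta_sq hx.1.1
  rw [← hsq] at hα hβ
  simp only [IsSepPoint, sepPointOf, sepU₁, sepU₂, f₁, f₂]
  refine ⟨?_, ?_, ?_, ?_⟩
  · field_simp
    linear_combination hα + alpha x 2 ^ 2 * hR
  · field_simp
    linear_combination a ^ 2 * h₁
  · field_simp
    linear_combination hβ + beta x 2 ^ 2 * hR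
  · field_simp
    linear_combination h₂

theorem cosE_sepPointOf : cosE a b (L a b ε x) m h (sepPointOf a b ε x)
    = -(alpha x 0 - beta x 1) / rootLam ε x := by
  have hs := rootLam_ne_zero hε hL
  have hA := leaf_minor_lt hb hab hx.1.1
  have ha : 0 < a := hb.trans hab
  have hr := r_pos hb hab
  have h₁ := J_sub_eq hb hab hx hL hε
  rw [cosE, Theta_sepPointOf hb hab hx hL hε, psi]
  simp only [sepPointOf, sepU₁, sepU₂]
  field_simp
  linear_combination h₁

theorem sinE_sepPointOf : sinE a b (sepPointOf a b ε x)
    = (alpha x 1 + beta x 0) / rootLam ε x := by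
  have hs := rootLam_ne_zero hε hL
  have hA := leaf_minor_lt hb hab hx.1.1
  have ha : 0 < a := hb.trans hab
  have hr := r_pos hb hab
  obtain ⟨-, -, h₁⟩ := J_products hb hab hx hL hε
  rw [sinE, Theta_sepPointOf hb hab hx hL hε]
  simp only [sepPointOf]
  field_simp
  linear_combination h₁

theorem expresses_sepPointOf : Expresses a b (L a b ε x) m h (sepPointOf a b ε x) x := by
  have hs := rootLam_ne_zero hε hL
  have hA := leaf_minor_lt hb hab hx.1.1
  have ha : 0 < a := hb.trans hab
  have hr := r_pos hb hab
  have hsq := rootLam_sq (x := x) hε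
  have hR := r_sq hb hab
  have hy := isSepPoint_sepPointOf hb hab hx hL hε
  have hD := (hy.sub_pos hb hab).ne'
  have hT := Theta_sepPointOf hb hab hx hL hε
  have hC := cosE_sepPointOf hb hab hx hL hε
  have hS := sinE_sepPointOf hb hab hx hL hε
  have hα := leaf_alpha_sq hx.1.1
  have hβ := leaf_beta_sq hx.1.1
  have hF := N_critOmega hb hab hx.1
  have hΛ : rootLam ε x ^ 2 = (alpha x 0 - beta x 1) ^ 2 + (alpha x 1 + beta x 0) ^ 2 := hsq
  obtain ⟨a₁, a₂⟩ := leaf_alpha_mul hx.1.1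
  obtain ⟨b₁, b₂⟩ := leaf_beta_mul hx.1.1
  rw [critOmega, ← hsq] at hF
  rw [← hsq] at hα hβ
  refine ⟨?_, ?_, ?_⟩ <;> funext i <;> fin_cases i
  · change alpha x 0 = alphaOf a b _ m h _ 0
    rw [alphaOf_zero, hT, hC, hS]
    simp only [sepPointOf, sepU₁, sepU₂]
    field_simp
    linear_combination r a b ^ 2 * (alpha x 0 * hΛ + (alpha x 0 - beta x 1) * a₁ - (alpha x 1 + beta x 0) * a₂)
      + (alpha x 0 - beta x 1) * ((a ^ 2 - minor x - alpha x 2 ^ 2) * hR - hα)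
  · change alpha x 1 = alphaOf a b _ m h _ 1
    rw [alphaOf_one, hT, hC, hS]
    simp only [sepPointOf, sepU₁, sepU₂]
    field_simp
    linear_combination r a b ^ 2 * (alpha x 1 * hΛ + (alpha x 1 + beta x 0) * a₁ + (alpha x 0 - beta x 1) * a₂)
      + (alpha x 1 + beta x 0) * ((a ^ 2 - minor x - alpha x 2 ^ 2) * hR - hα)
  · change alpha x 2 = alphaOf a b _ m h _ 2
    rw [alphaOf_two, hT]
    simp only [sepPointOf]
    field_simp
  · change beta x 0 = betaOf a b _ m h _ 0
    rw [betaOf_zero, hT, hC, hS]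
    simp only [sepPointOf, sepU₁, sepU₂]
    field_simp
    linear_combination r a b ^ 2 * (beta x 0 * hΛ + (alpha x 0 - beta x 1) * b₂ - (alpha x 1 + beta x 0) * b₁)
      + (alpha x 1 + beta x 0) * ((b ^ 2 - minor x - beta x 2 ^ 2) * hR - hβ)
  · change beta x 1 = betaOf a b _ m h _ 1
    rw [betaOf_one, hT, hC, hS]
    simp only [sepPointOf, sepU₁, sepU₂]
    field_simp
    linear_combination r a b ^ 2 * (beta x 1 * hΛ + (alpha x 0 - beta x 1) * b₁ + (alpha x 1 + beta x 0) * b₂)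
      - (alpha x 0 - beta x 1) * ((b ^ 2 - minor x - beta x 2 ^ 2) * hR - hβ)
  · change beta x 2 = betaOf a b _ m h _ 2
    rw [betaOf_two, hT]
    simp only [sepPointOf, sepU₁]
    field_simp
  · change omega x 0 = omegaOf a b _ m _ 0
    rw [omegaOf_zero hD hy, hT, hC, hS]
    simp only [sepPointOf, sepU₁]
    field_simp
    linear_combination omega x 0 * hΛ
  · change omega x 1 = omegaOf a b _ m _ 1
    rw [omegaOf_one hD hy, hT, hC, hS]
    simp only [sepPointOf, sepU₁]
    field_simp
    linear_combination omega x 1 * hΛ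
  · change omega x 2 = omegaOf a b _ m _ 2
    rw [omegaOf_two, hT]
    simp only [sepPointOf]
    field_simp
    linear_combination hF

end SepPointOf

end Regular

/-! ### The points with `Λ = 0` -/

section Singular

variable {a b m h : ℝ} {x : Phase}

/-- In `leaf_beta_sq` with Λ = 0 a nonnegative quantity equals a nonpositive one, so β₃ = 0 and the
minor equals b². -/
theorem leaf_of_lam_eq_zero (hb : 0 < b) (hab : b < a) (hx : x ∈ leaf a b) (hL : Lam x = 0) :
    beta x 0 = -alpha x 1 ∧ beta x 1 = alpha x 0 ∧ beta x 2 = 0 ∧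
      alpha x 2 ^ 2 = r a b ^ 2 ∧ alpha x 0 ^ 2 + alpha x 1 ^ 2 = b ^ 2 := by
  have hR : 0 < a ^ 2 - b ^ 2 := by nlinarith
  have h₁ : alpha x 0 - beta x 1 = 0 := by
    rw [Lam] at hL; rw [← sq_eq_zero_iff]; nlinarith
  have h₂ : alpha x 1 + beta x 0 = 0 := by
    rw [Lam] at hL; rw [← sq_eq_zero_iff]; nlinarith
  have hβ := leaf_beta_sq hx
  have hα := leaf_alpha_sq hx
  rw [hL] at hα hβ
  have h₃ : beta x 2 = 0 := by
    rw [← sq_eq_zero_iff]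
    have : (a ^ 2 - b ^ 2) * beta x 2 ^ 2 ≤ 0 := by nlinarith [sq_nonneg (b ^ 2 - minor x)]
    nlinarith [sq_nonneg (beta x 2)]
  have h₄ : minor x = b ^ 2 := by
    rw [h₃] at hβ
    have : b ^ 2 - minor x = 0 := by rw [← sq_eq_zero_iff]; linear_combination hβ
    linear_combination -this
  refine ⟨by linear_combination h₂, by linear_combination -h₁, h₃, ?_, ?_⟩
  · rw [h₄] at hα
    rw [r_sq hb hab]
    apply mul_left_cancel₀ hR.ne'
    linear_combination hα
  · rw [← h₄, minor]
    linear_combination alpha x 0 * h₁ + alpha x 1 * h₂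

theorem J_omega_sq_of_lam_eq_zero (hb : 0 < b) (hab : b < a) (hx : x ∈ J a b m h)
    (hL : Lam x = 0) : omega x 0 ^ 2 + omega x 1 ^ 2 = -(r a b ^ 2 * m) := by
  have hr := r_pos hb hab
  obtain ⟨b₀, b₁, b₂, hα, -⟩ := leaf_of_lam_eq_zero hb hab hx.1.1 hL
  have hG := J_two_G hb hab hx
  obtain ⟨e₁, e₂, -⟩ := hx.1.1
  rw [p_sq, ← e₁, ← e₂, show r a b ^ 4 = (r a b ^ 2) ^ 2 by ring, ← hα] at hG
  simp only [G, H, dot_eq, b₀, b₁, b₂] at hG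
  rw [← hα]
  have h₁ : alpha x 2 ^ 2 ≠ 0 := by rw [hα]; positivity
  apply mul_left_cancel₀ h₁
  linear_combination -hG

theorem J_omega_two_of_lam_eq_zero (hb : 0 < b) (hab : b < a) (hx : x ∈ J a b m h)
    (hL : Lam x = 0) (hm : m ≠ 0) :
    r a b ^ 2 * m * omega x 2 = alpha x 2 *
      (omega x 0 - 2 * m * (omega x 0 * alpha x 0 + omega x 1 * alpha x 1)) := by
  have hr := r_pos hb hab
  obtain ⟨b₀, b₁, b₂, hα, -⟩ := leaf_of_lam_eq_zero hb hab hx.1.1 hL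
  have hW := J_omega_sq_of_lam_eq_zero hb hab hx hL
  -- The infinitesimal rotation of α and β about (ω₂, -ω₁, 0) with ω fixed; rotations preserve the
  -- leaf. Criticality of F in this direction replaces the equation c = 0, which no longer
  -- determines ω₃.
  set v : Phase := ofOmega 0
    ![omega x 0 * alpha x 2, omega x 1 * alpha x 2,
      -(omega x 0 * alpha x 0 + omega x 1 * alpha x 1)]
    ![0, 0, omega x 0 * alpha x 1 - omega x 1 * alpha x 0] with hv
  have ht : IsTangent x v := by
    simp only [IsTangent, hv, alpha_ofOmega, beta_ofOmega, dot_eq, Matrix.cons_val, b₀, b₁, b₂]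
    refine ⟨?_, ?_, ?_⟩ <;> ring
  have h₁ := hx.1.2.2 v ht
  rw [fderiv_F, J_two_G hb hab hx] at h₁
  have h₂ : 2 * dG x v - p a b ^ 2 * dH x v = alpha x 2 * (4 * (omega x 0 ^ 2 + omega x 1 ^ 2)
      * (omega x 0 * alpha x 0 + omega x 1 * alpha x 1) + r a b ^ 2 * omega x 0)
      + 2 * omega x 2 * r a b ^ 2 * (omega x 0 ^ 2 + omega x 1 ^ 2) := by
    obtain ⟨e₁, e₂, -⟩ := hx.1.1
    rw [p_sq, ← e₁, ← e₂, ← hα]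
    simp only [dG, dH, hv, omega_ofOmega, alpha_ofOmega, beta_ofOmega, dot_eq, Matrix.cons_val,
      b₀, b₁, b₂, Pi.zero_apply]
    ring
  have h₃ : dK x v = 2 * alpha x 2 * omega x 0 * (omega x 0 ^ 2 + omega x 1 ^ 2) := by
    simp only [dK, hv, omega_ofOmega, alpha_ofOmega, beta_ofOmega, Matrix.cons_val,
      b₀, b₁, Pi.zero_apply]
    ring
  rw [h₂, h₃, hW] at h₁
  have h₄ : r a b ^ 6 * m ≠ 0 := mul_ne_zero (by positivity) hm
  apply mul_left_cancel₀ h₄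
  linear_combination -h₁ / 4

theorem exists_sepPoint_of_lam_eq_zero (hb : 0 < b) (hab : b < a) (hx : x ∈ J a b m h)
    (hL : Lam x = 0) : ∃ (ℓ : ℝ) (y : SepPoint), ConstRel a b ℓ m h ∧
      IsSepPoint a b ℓ m h y ∧ Expresses a b ℓ m h y x := by
  have hr := r_pos hb hab
  have hR := r_sq hb hab
  have ha : 0 < a := hb.trans hab
  obtain ⟨b₀, b₁, b₂, hα, hα'⟩ := leaf_of_lam_eq_zero hb hab hx.1.1 hL
  have hW := J_omega_sq_of_lam_eq_zero hb hab hx hL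
  have hH : H x = h := hx.2.2
  rw [H, b₁] at hH
  by_cases hm : m = 0
  · subst hm
    have w₀ : omega x 0 = 0 := by rw [← sq_eq_zero_iff]; nlinarith
    have w₁ : omega x 1 = 0 := by rw [← sq_eq_zero_iff]; nlinarith
    rw [w₀, w₁] at hH
    -- For m = 0 and w = 0 either sign ℓ = ±1 satisfies (1). With ℓ = 1, u₁ = P₁ = 0 and Θ = 1/a,
    -- the formulas (3) for α₃, α₁, α₂, ω₃ give Q₁, u₂, Q₂, P₂ in turn.
    refine ⟨1, ⟨0, alpha x 2 / r a b, 0, -(alpha x 0 / b), alpha x 1 * alpha x 2 / (b * r a b),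
      -(omega x 2 * alpha x 2 / (2 * r a b))⟩, by simp [ConstRel], ?_, ?_⟩
    · simp only [IsSepPoint, f₁, f₂, hStar]
      refine ⟨?_, ?_, ?_, ?_⟩
      · field_simp; linear_combination hα
      · ring
      · field_simp; linear_combination alpha x 1 ^ 2 * hα + r a b ^ 2 * hα'
      · field_simp; linear_combination omega x 2 ^ 2 * hα + 2 * r a b ^ 2 * hH
    · refine ⟨?_, ?_, ?_⟩ <;> funext i <;> fin_cases i <;>
        simp only [alphaOf, betaOf, omegaOf, Theta, psi, hStar, b₀, b₁, b₂, w₀, w₁,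
          Fin.zero_eta, Fin.mk_one, Fin.reduceFinMk, Matrix.cons_val, mul_zero, zero_mul, sub_zero, zero_sub, zero_add, add_zero]
      · field_simp
      · field_simp; linear_combination -alpha x 1 * hα
      · field_simp
      · field_simp; linear_combination alpha x 1 * hα
      · field_simp
      · field_simp; linear_combination -omega x 2 * hα
  · have hm' : m < 0 := by
      refine lt_of_le_of_ne ?_ hm
      have : 0 < r a b ^ 2 := by positivity
      nlinarith [sq_nonneg (omega x 0), sq_nonneg (omega x 1)]
    have hω := J_omega_two_of_lam_eq_zero hb hab hx hL hm
    -- At u₁ = 0 the radicand of P₁ is -a²m, so P₁ = aq is one of its roots.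
    obtain ⟨q, hq, hq'⟩ : ∃ q : ℝ, 0 < q ∧ q ^ 2 = -m :=
      ⟨√(-m), Real.sqrt_pos.2 (by linarith), Real.sq_sqrt (by linarith)⟩
    obtain rfl : m = -q ^ 2 := by linear_combination hq'
    have hω' : omega x 2 ^ 2 * r a b ^ 2 * q ^ 4
        = (omega x 0 + 2 * q ^ 2 * (omega x 0 * alpha x 0 + omega x 1 * alpha x 1)) ^ 2 := by
      have : r a b ^ 2 ≠ 0 := by positivity
      apply mul_left_cancel₀ this
      linear_combination (r a b ^ 2 * -q ^ 2 * omega x 2 + alpha x 2 *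
        (omega x 0 - 2 * -q ^ 2 * (omega x 0 * alpha x 0 + omega x 1 * alpha x 1))) * hω
        + (omega x 0 + 2 * q ^ 2 * (omega x 0 * alpha x 0 + omega x 1 * alpha x 1)) ^ 2 * hα
    -- The relation (1) for the ℓ chosen below, with denominators cleared; ω₃ enters through H only
    -- as a square, hence `hω'`.
    have hc : 2 * (2 * q ^ 2 * (omega x 0 * alpha x 1 - omega x 1 * alpha x 0) - omega x 1) ^ 2
        + q ^ 4 * r a b ^ 2 * 4 * (h + -(q ^ 2 * (a ^ 2 + b ^ 2))) = 2 * q ^ 2 * r a b ^ 2 := by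
      linear_combination -(4 * q ^ 4 * r a b ^ 2) * hH + 2 * hω'
        + 8 * q ^ 4 * (omega x 0 ^ 2 + omega x 1 ^ 2) * hα'
        + (8 * q ^ 4 * b ^ 2 + 2 + 8 * q ^ 2 * alpha x 0 + 4 * q ^ 4 * r a b ^ 2) * hW
        + 4 * q ^ 6 * r a b ^ 2 * hR
    -- Here Θ = 1/a and w = irqe, so e = -iw/(rq). Then α₁ + iα₂ = -Ae gives u₂ and Q₁Q₂, hence Q₂
    -- as Q₁ = ±1; the formulas for ω₁ and ω₂ give P₂ and ℓ.
    refine ⟨-(2 * q ^ 2) * (-(omega x 0 * alpha x 1 - omega x 1 * alpha x 0) / (r a b * q))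
        - omega x 1 / (r a b * q),
      ⟨0, alpha x 2 / r a b, a * q,
        -(omega x 0 * alpha x 1 - omega x 1 * alpha x 0) / (b * (r a b * q)),
        -(alpha x 2 * (omega x 0 * alpha x 0 + omega x 1 * alpha x 1)) / (b * r a b ^ 2 * q),
        omega x 0 / (2 * r a b * q ^ 2)⟩, ?_, ?_, ?_⟩
    · rw [constRel_iff, hStar, p_sq]
      field_simp
      linear_combination hc
    · simp only [IsSepPoint, f₁, f₂]
      refine ⟨?_, ?_, ?_, ?_⟩
      · field_simp; linear_combination hα
      · ring
      · field_simp
        linear_combination (omega x 0 * alpha x 0 + omega x 1 * alpha x 1) ^ 2 * hα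
          + r a b ^ 2 * ((omega x 0 ^ 2 + omega x 1 ^ 2) * hα' + b ^ 2 * hW)
      · rw [hStar, p_sq]
        field_simp
        linear_combination hW - hc / 2
    · refine ⟨?_, ?_, ?_⟩ <;> funext i <;> fin_cases i <;>
        simp only [alphaOf, betaOf, omegaOf, Theta, psi, hStar, b₀, b₁, b₂,
          Fin.zero_eta, Fin.mk_one, Fin.reduceFinMk, Matrix.cons_val, mul_zero, zero_mul, sub_zero, zero_sub, add_zero]
      · field_simp
        linear_combination -alpha x 0 * r a b ^ 2 * hW
          - omega x 0 * (omega x 0 * alpha x 0 + omega x 1 * alpha x 1) * hα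
      · field_simp
        linear_combination -alpha x 1 * r a b ^ 2 * hW
          - omega x 1 * (omega x 0 * alpha x 0 + omega x 1 * alpha x 1) * hα
      · field_simp
      · field_simp
        linear_combination alpha x 1 * r a b ^ 2 * hW
          + omega x 1 * (omega x 0 * alpha x 0 + omega x 1 * alpha x 1) * hα
      · field_simp
        linear_combination -alpha x 0 * r a b ^ 2 * hW
          - omega x 0 * (omega x 0 * alpha x 0 + omega x 1 * alpha x 1) * hα
      · field_simp
      · field_simp; ring
      · field_simp
        linear_combination -hω

end Singular

open Set Filter Topology

/-! ### Existence and uniqueness for the separated and the Euler equations -/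

theorem eq_of_hasDerivAt_zero {f : ℝ → ℝ} {t₀ δ : ℝ}
    (hf : ∀ t ∈ Ioo (t₀ - δ) (t₀ + δ), HasDerivAt f 0 t) {t : ℝ}
    (ht : t ∈ Ioo (t₀ - δ) (t₀ + δ)) : f t = f t₀ :=
  isOpen_Ioo.is_const_of_deriv_eq_zero isPreconnected_Ioo
    (fun s hs => (hf s hs).differentiableAt.differentiableWithinAt)
    (fun s hs => (hf s hs).deriv) ht ⟨by linarith [ht.1, ht.2], by linarith [ht.1, ht.2]⟩

/-- The separated equations as a vector field in the variables `u₁, Q₁, P₁, u₂, Q₂, P₂`. -/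
def sepField (a b ℓ m h : ℝ) (e : Fin 6 → ℝ) : Fin 6 → ℝ :=
  ![e 1 * e 2, -(e 0 * e 2), e 1 * (hStar a b m h * e 0 + a * ℓ / 2),
    e 4 * e 5, -(e 3 * e 5), e 4 * (b ^ 2 * m * e 3 - b * ℓ / 2)]

theorem contDiff_sepField (a b ℓ m h : ℝ) : ContDiff ℝ 1 (sepField a b ℓ m h) := by
  rw [contDiff_pi]
  intro i
  fin_cases i <;> simp only [sepField, Fin.zero_eta, Fin.mk_one, Fin.reduceFinMk, Matrix.cons_val] <;>
    fun_prop

theorem exists_isSepFlowAt {a b ℓ m h : ℝ} (t₀ : ℝ) {y₀ : SepPoint}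
    (hy₀ : IsSepPoint a b ℓ m h y₀) :
    ∃ (y : ℝ → SepPoint) (δ : ℝ), 0 < δ ∧ y t₀ = y₀ ∧ ∀ t ∈ Ioo (t₀ - δ) (t₀ + δ),
      IsSepFlowAt a b ℓ m h y t ∧ IsSepPoint a b ℓ m h (y t) := by
  obtain ⟨e, he, δ, hδ, hd⟩ := (contDiff_sepField a b ℓ m h).contDiffAt
    (x := ![y₀.u₁, y₀.Q₁, y₀.P₁, y₀.u₂, y₀.Q₂, y₀.P₂])
    |>.exists_forall_mem_closedBall_exists_eq_forall_mem_Ioo_hasDerivAt₀ t₀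
  let y : ℝ → SepPoint := fun t => ⟨e t 0, e t 1, e t 2, e t 3, e t 4, e t 5⟩
  have hyt : y t₀ = y₀ := by simp [y, he]
  have hf : ∀ t ∈ Ioo (t₀ - δ) (t₀ + δ), IsSepFlowAt a b ℓ m h y t := fun t ht => by
    have h₁ := hasDerivAt_pi.1 (hd t ht)
    exact ⟨h₁ 0, h₁ 1, h₁ 2, h₁ 3, h₁ 4, h₁ 5⟩
  refine ⟨y, δ, hδ, hyt, fun t ht => ⟨hf t ht, ?_⟩⟩
  obtain ⟨i₁, i₂, i₃, i₄⟩ := hy₀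
  rw [← hyt] at i₁ i₂ i₃ i₄
  -- The four relations between the variables and their radicals are first integrals of the
  -- polynomial field, so they persist from y₀.
  have c₁ := eq_of_hasDerivAt_zero (f := fun s => (y s).Q₁ ^ 2 + (y s).u₁ ^ 2)
    (fun s hs => (((hf s hs).Q₁.pow 2).add ((hf s hs).u₁.pow 2)).congr_deriv (by
      push_cast; ring)) ht
  have c₂ := eq_of_hasDerivAt_zero (f := fun s => (y s).P₁ ^ 2 - f₁ a b ℓ m h (y s).u₁)
    (fun s hs => (((hf s hs).P₁.pow 2).sub (((((hf s hs).u₁.pow 2).const_mul (hStar a b m h)).add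
      ((hf s hs).u₁.const_mul (a * ℓ))).sub_const (a ^ 2 * m))).congr_deriv (by
      push_cast; ring)) ht
  have c₃ := eq_of_hasDerivAt_zero (f := fun s => (y s).Q₂ ^ 2 + (y s).u₂ ^ 2)
    (fun s hs => (((hf s hs).Q₂.pow 2).add ((hf s hs).u₂.pow 2)).congr_deriv (by
      push_cast; ring)) ht
  have c₄ := eq_of_hasDerivAt_zero (f := fun s => (y s).P₂ ^ 2 - f₂ a b ℓ m h (y s).u₂)
    (fun s hs => (((hf s hs).P₂.pow 2).sub (((((hf s hs).u₂.pow 2).const_mul (b ^ 2 * m)).sub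
      ((hf s hs).u₂.const_mul (b * ℓ))).sub_const (hStar a b m h))).congr_deriv (by
      push_cast; ring)) ht
  exact ⟨by linear_combination c₁ + i₁, by linear_combination c₂ + i₂,
    by linear_combination c₃ + i₃, by linear_combination c₄ + i₄⟩

theorem contDiff_eulerField : ContDiff ℝ 1 (eulerField H) := by
  rw [show eulerField H = _ from funext eulerField_H]
  unfold ofOmega omega alpha beta mom
  refine ContDiff.prodMk ?_ (ContDiff.prodMk ?_ ?_) <;> rw [contDiff_pi] <;> intro i <;>
    fin_cases i <;>
    simp only [Fin.zero_eta, Fin.mk_one, Fin.reduceFinMk, Matrix.cons_val] <;> fun_prop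

theorem eventuallyEq_of_eulerField {γ₁ γ₂ : ℝ → Phase} {t₀ : ℝ}
    (h₁ : ∀ᶠ t in 𝓝 t₀, HasDerivAt γ₁ (eulerField H (γ₁ t)) t)
    (h₂ : ∀ᶠ t in 𝓝 t₀, HasDerivAt γ₂ (eulerField H (γ₂ t)) t) (h₀ : γ₁ t₀ = γ₂ t₀) :
    γ₁ =ᶠ[𝓝 t₀] γ₂ := by
  obtain ⟨k, s, hs, hk⟩ := contDiff_eulerField.contDiffAt (x := γ₁ t₀) |>.exists_lipschitzOnWith
  refine ODE_solution_unique_of_eventually (v := fun _ => eulerField H) (s := fun _ => s)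
    (K := k) (.of_forall fun _ => hk) (h₁.and ?_) (h₂.and ?_) h₀
  · exact h₁.self_of_nhds.continuousAt.eventually hs
  · exact h₂.self_of_nhds.continuousAt.eventually (h₀ ▸ hs)

/-! ### First integrals -/

theorem dH_eulerField (x : Phase) : dH x (eulerField H x) = 0 := by
  rw [eulerField_H]
  simp only [dH, omega_ofOmega, alpha_ofOmega, beta_ofOmega, Matrix.cons_val]
  ring

theorem dG_eulerField (x : Phase) : dG x (eulerField H x) = 0 := by
  rw [eulerField_H]
  simp only [dG, omega_ofOmega, alpha_ofOmega, beta_ofOmega, Matrix.cons_val]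
  ring

theorem hasDerivAt_H_zero {γ : ℝ → Phase} {t : ℝ} (h : HasDerivAt γ (eulerField H (γ t)) t) :
    HasDerivAt (fun s => H (γ s)) 0 t :=
  (hasDerivAt_H h).congr_deriv (dH_eulerField _)

theorem hasDerivAt_M_zero (a b : ℝ) {γ : ℝ → Phase} {t : ℝ}
    (h : HasDerivAt γ (eulerField H (γ t)) t) : HasDerivAt (fun s => M a b (γ s)) 0 t := by
  refine ((((hasDerivAt_G h).const_mul 2).sub ((hasDerivAt_H h).const_mul (p a b ^ 2))).div_const
    (r a b ^ 4)).congr_deriv ?_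
  rw [dG_eulerField, dH_eulerField]; simp

/-! ### The separation variables along the motion -/

/-- A derivative along γ may be computed along any other curve c with the same point and velocity.
-/
theorem hasDerivAt_comp_of_curve {f : Phase → ℝ} {x v : Phase} {γ c : ℝ → Phase} {t d : ℝ}
    (hf : DifferentiableAt ℝ f x) (hc : c t = x) (hc' : HasDerivAt c v t)
    (hd : HasDerivAt (fun s => f (c s)) d t) (hx : γ t = x) (hγ : HasDerivAt γ v t) :
    HasDerivAt (fun s => f (γ s)) d t := by
  rw [← fderiv_eq_of_hasDerivAt_comp hf hc hc' hd]
  subst hx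
  exact hf.hasFDerivAt.comp_hasDerivAt t hγ

section

variable {a b m h ε : ℝ} {x : Phase}

theorem differentiableAt_rootLam (hL : Lam x ≠ 0) : DifferentiableAt ℝ (rootLam ε) x := by
  have := differentiable_alpha; have := differentiable_beta
  have h₁ : Differentiable ℝ Lam := by unfold Lam; fun_prop
  exact ((h₁ x).sqrt hL).const_mul ε

theorem differentiable_minor : Differentiable ℝ minor := by
  have := differentiable_alpha; have := differentiable_beta
  unfold minor; fun_prop

theorem mul_abs_eq_of_mul_pos {u : ℝ} (hε : ε = 1 ∨ ε = -1) (h : 0 < ε * u) : ε * |u| = u := by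
  rcases hε with rfl | rfl
  · rw [abs_of_pos (by linarith)]; ring
  · rw [abs_of_neg (by linarith)]; ring

theorem hasDerivAt_sepU (hb : 0 < b) (hab : b < a) (hx : x ∈ J a b m h) (hL : Lam x ≠ 0)
    (hε : ε = 1 ∨ ε = -1) {γ : ℝ → Phase} {t : ℝ} (hγt : γ t = x)
    (hγ : HasDerivAt γ (eulerField H x) t) :
    HasDerivAt (fun s => sepU₁ a ε (γ s)) ((sepPointOf a b ε x).Q₁ * (sepPointOf a b ε x).P₁) t ∧
      HasDerivAt (fun s => sepU₂ b ε (γ s))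
        ((sepPointOf a b ε x).Q₂ * (sepPointOf a b ε x).P₂) t := by
  have hy₀ := isSepPoint_sepPointOf hb hab hx hL hε
  have hc := J_constRel hb hab hx hL hε
  have hA := leaf_minor_lt hb hab hx.1.1
  have hs := rootLam_ne_zero hε hL
  have hroot := differentiableAt_rootLam (ε := ε) hL
  have hminor := differentiable_minor x
  have ha : 0 < a := hb.trans hab
  obtain ⟨y, δ, hδ, hyt, hy⟩ := exists_isSepFlowAt t hy₀
  have hnear : ∀ᶠ s in 𝓝 t, s ∈ Ioo (t - δ) (t + δ) :=
    Ioo_mem_nhds (by linarith) (by linarith)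
  have hyt' := hy t hnear.self_of_nhds
  have hx' : phaseOf a b (L a b ε x) m h (y t) = x := by
    rw [hyt, ← (expresses_sepPointOf hb hab hx hL hε).eq_phaseOf]
  have hflow := hyt'.1.hasDerivAt_phaseOf hb hab hc hyt'.2
  rw [hx'] at hflow
  -- The sign of u₁ at the point is ε because a² - Δ > 0; by continuity it stays so nearby, and
  -- `sep_eq` applies with the same branch.
  have hu : 0 < ε * (y t).u₁ := by
    have h₁ : 0 < √(Lam x) := Real.sqrt_pos.2 (lt_of_le_of_ne (by unfold Lam; positivity) hL.symm)
    have h₂ : ε * (y t).u₁ = ε ^ 2 * (a * √(Lam x) / (a ^ 2 - minor x)) := by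
      rw [hyt, sepPointOf]; simp only [sepU₁, rootLam]; ring
    have h₃ : ε ^ 2 = 1 := by rcases hε with rfl | rfl <;> norm_num
    rw [h₂, h₃]; positivity
  have hev : ∀ᶠ s in 𝓝 t, (y s).u₁ = sepU₁ a ε (phaseOf a b (L a b ε x) m h (y s)) ∧
      (y s).u₂ = sepU₂ b ε (phaseOf a b (L a b ε x) m h (y s)) := by
    filter_upwards [hnear, (hyt'.1.u₁.continuousAt.const_mul ε).eventually (lt_mem_nhds hu)]
      with s hs₁ hs₂
    have h₁ := (expresses_phaseOf a b (L a b ε x) m h (y s)).sep_eq hb hab hc (hy s hs₁).2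
      (mul_abs_eq_of_mul_pos hε hs₂) (by rintro h₀; simp [h₀] at hs₂)
    exact ⟨h₁.1, h₁.2.1⟩
  rw [← hyt]
  constructor
  · refine hasDerivAt_comp_of_curve ?_ hx' hflow (hyt'.1.u₁.congr_of_eventuallyEq
      (hev.mono fun s hs => hs.1.symm)) hγt hγ
    have h₁ := hA.ne'
    unfold sepU₁; fun_prop (disch := assumption)
  · refine hasDerivAt_comp_of_curve ?_ hx' hflow (hyt'.1.u₂.congr_of_eventuallyEq
      (hev.mono fun s hs => hs.2.symm)) hγt hγ
    have h₁ := mul_ne_zero hb.ne' hs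
    unfold sepU₂; fun_prop (disch := assumption)

theorem exists_sepPoint (hb : 0 < b) (hab : b < a) (hx : x ∈ J a b m h) :
    ∃ (ℓ : ℝ) (y : SepPoint), ConstRel a b ℓ m h ∧
      IsSepPoint a b ℓ m h y ∧ Expresses a b ℓ m h y x := by
  by_cases hL : Lam x = 0
  · exact exists_sepPoint_of_lam_eq_zero hb hab hx hL
  · exact ⟨_, _, J_constRel hb hab hx hL (.inl rfl), isSepPoint_sepPointOf hb hab hx hL (.inl rfl),
      expresses_sepPointOf hb hab hx hL (.inl rfl)⟩

theorem exists_sepCurve (hb : 0 < b) (hab : b < a) {I : Set ℝ} {γ : ℝ → Phase} (hI : IsOpen I)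
    (hγ : ∀ t ∈ I, γ t ∈ N a b ∧ HasDerivAt γ (eulerField H (γ t)) t) {t₀ : ℝ} (ht₀ : t₀ ∈ I) :
    ∃ (δ ℓ m h : ℝ) (y : ℝ → SepPoint), 0 < δ ∧ ConstRel a b ℓ m h ∧
      ∀ t ∈ Ioo (t₀ - δ) (t₀ + δ), γ t ∈ J a b m h ∧ IsSepPoint a b ℓ m h (y t) ∧
        Expresses a b ℓ m h (y t) (γ t) ∧ IsSepFlowAt a b ℓ m h y t := by
  have hJ : γ t₀ ∈ J a b (M a b (γ t₀)) (H (γ t₀)) := ⟨(hγ t₀ ht₀).1, rfl, rfl⟩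
  obtain ⟨ℓ, y₀, hc, hy₀, hx₀⟩ := exists_sepPoint hb hab hJ
  obtain ⟨y, δ₁, hδ₁, hyt, hy⟩ := exists_isSepFlowAt t₀ hy₀
  have hnear : ∀ᶠ s in 𝓝 t₀, s ∈ Ioo (t₀ - δ₁) (t₀ + δ₁) :=
    Ioo_mem_nhds (by linarith) (by linarith)
  -- Both curves solve the Euler equations and agree at t₀, whether or not Λ vanishes there.
  have heq : γ =ᶠ[𝓝 t₀] fun s => phaseOf a b ℓ (M a b (γ t₀)) (H (γ t₀)) (y s) := by
    refine eventuallyEq_of_eulerField ?_ ?_ ?_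
    · filter_upwards [hI.mem_nhds ht₀] with t ht using (hγ t ht).2
    · filter_upwards [hnear] with t ht
      exact (hy t ht).1.hasDerivAt_phaseOf hb hab hc (hy t ht).2
    · simp only [hyt]; exact hx₀.eq_phaseOf
  obtain ⟨δ, hδ, hball⟩ := Metric.eventually_nhds_iff_ball.1
    ((hI.eventually_mem ht₀).and (hnear.and heq))
  rw [Real.ball_eq_Ioo] at hball
  refine ⟨δ, ℓ, _, _, y, hδ, hc, fun t ht => ?_⟩
  obtain ⟨htI, ht₁, ht₂⟩ := hball t ht
  refine ⟨⟨(hγ t htI).1, ?_, ?_⟩, (hy t ht₁).2, ?_, (hy t ht₁).1⟩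
  · exact eq_of_hasDerivAt_zero (f := fun s => M a b (γ s))
      (fun s hs => hasDerivAt_M_zero a b (hγ s (hball s hs).1).2) ht
  · exact eq_of_hasDerivAt_zero (f := fun s => H (γ s))
      (fun s hs => hasDerivAt_H_zero (hγ s (hball s hs).1).2) ht
  · rw [ht₂]; exact expresses_phaseOf _ _ _ _ _ _

end

/-! ### The roots of the radicands -/

/-- The discriminant a²(ℓ² + 4mh_*) equals a², and ℓ² - 1 = -4mh_* brings the roots to the stated
form; ℓ ≠ ±1 also ensures h_* ≠ 0. -/
theorem f₁_eq {a b ℓ m h : ℝ} (hc : ConstRel a b ℓ m h) (h₁ : ℓ ≠ 1) (h₂ : ℓ ≠ -1) (u : ℝ) :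
    f₁ a b ℓ m h u =
      hStar a b m h * (u - 2 * a * m / (ℓ - 1)) * (u - 2 * a * m / (ℓ + 1)) := by
  rw [constRel_iff] at hc
  have e₁ : ℓ - 1 ≠ 0 := sub_ne_zero.2 h₁
  have e₂ : ℓ + 1 ≠ 0 := fun h₀ => h₂ (by linarith)
  rw [f₁]
  field_simp
  linear_combination (a * ℓ * u - a ^ 2 * m) * hc

theorem f₂_eq {a b ℓ m h : ℝ} (hb : b ≠ 0) (hc : ConstRel a b ℓ m h) (hm : m ≠ 0) (u : ℝ) :
    f₂ a b ℓ m h u =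
      b ^ 2 * (m * (u - (ℓ - 1) / (2 * b * m)) * (u - (ℓ + 1) / (2 * b * m))) := by
  rw [constRel_iff] at hc
  rw [f₂]
  field_simp
  linear_combination -hc

end RS

end

theorem proposition1 (a b : ℝ) (hb : 0 < b) (hab : b < a) :
    -- the radicands in terms of the roots `τ_{1,2} = 2am/(ℓ ∓ 1)`, `σ_{1,2} = (ℓ ∓ 1)/(2bm)`,
    -- wherever the roots are defined
    (∀ ℓ m h u : ℝ, RS.ConstRel a b ℓ m h →
      (ℓ ≠ 1 → ℓ ≠ -1 → RS.f₁ a b ℓ m h u =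
        RS.hStar a b m h * (u - 2 * a * m / (ℓ - 1)) * (u - 2 * a * m / (ℓ + 1))) ∧
      (m ≠ 0 → RS.f₂ a b ℓ m h u =
        b ^ 2 * (m * (u - (ℓ - 1) / (2 * b * m)) * (u - (ℓ + 1) / (2 * b * m))))) ∧
    -- every point of `J_{m,h}`, also with `Λ = 0`
    (∀ (m h : ℝ) (x : RS.Phase), x ∈ RS.J a b m h →
      ∃ (ℓ : ℝ) (y : RS.SepPoint), RS.ConstRel a b ℓ m h ∧ |y.u₁| ≤ 1 ∧ |y.u₂| ≤ 1 ∧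
        RS.IsSepPoint a b ℓ m h y ∧ RS.Expresses a b ℓ m h y x) ∧
    -- where `Λ ≠ 0`, for either branch of `√Λ`, with the explicit variables `u₁, u₂`
    (∀ (m h : ℝ) (x : RS.Phase) (ε : ℝ), x ∈ RS.J a b m h → RS.Lam x ≠ 0 → (ε = 1 ∨ ε = -1) →
      ∃ y : RS.SepPoint, y.u₁ = RS.sepU₁ a ε x ∧ y.u₂ = RS.sepU₂ b ε x ∧
        |y.u₁| ≤ 1 ∧ |y.u₂| ≤ 1 ∧
        RS.ConstRel a b (RS.L a b ε x) m h ∧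
        RS.IsSepPoint a b (RS.L a b ε x) m h y ∧
        RS.Expresses a b (RS.L a b ε x) m h y x ∧
        ∀ (γ : ℝ → RS.Phase) (t : ℝ), γ t = x → HasDerivAt γ (RS.eulerField RS.H x) t →
          HasDerivAt (fun s => RS.sepU₁ a ε (γ s)) (y.Q₁ * y.P₁) t ∧
          HasDerivAt (fun s => RS.sepU₂ b ε (γ s)) (y.Q₂ * y.P₂) t) ∧
    -- along every motion on `N`, also when it meets `Λ = 0`
    (∀ (I : Set ℝ) (γ : ℝ → RS.Phase), IsOpen I →
      (∀ t ∈ I, γ t ∈ RS.N a b ∧ HasDerivAt γ (RS.eulerField RS.H (γ t)) t) →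
      ∀ t₀ ∈ I, ∃ (δ : ℝ) (ℓ m h : ℝ) (y : ℝ → RS.SepPoint), 0 < δ ∧ RS.ConstRel a b ℓ m h ∧
        ∀ t ∈ Set.Ioo (t₀ - δ) (t₀ + δ),
          γ t ∈ RS.J a b m h ∧ |(y t).u₁| ≤ 1 ∧ |(y t).u₂| ≤ 1 ∧
          RS.IsSepPoint a b ℓ m h (y t) ∧ RS.Expresses a b ℓ m h (y t) (γ t) ∧
          HasDerivAt (fun s => (y s).u₁) ((y t).Q₁ * (y t).P₁) t ∧
          HasDerivAt (fun s => (y s).u₂) ((y t).Q₂ * (y t).P₂) t ∧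
          ContinuousAt (fun s => (y s).Q₁) t ∧ ContinuousAt (fun s => (y s).P₁) t ∧
          ContinuousAt (fun s => (y s).Q₂) t ∧ ContinuousAt (fun s => (y s).P₂) t ∧
          (RS.Lam (γ t) ≠ 0 → ∃ ε : ℝ, (ε = 1 ∨ ε = -1) ∧
            (y t).u₁ = RS.sepU₁ a ε (γ t) ∧ (y t).u₂ = RS.sepU₂ b ε (γ t) ∧
            ℓ = RS.L a b ε (γ t))) := by
  refine ⟨fun ℓ m h u hc => ⟨fun h₁ h₂ => RS.f₁_eq hc h₁ h₂ u, fun hm => RS.f₂_eq hb.ne' hc hm u⟩,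
    fun m h x hx => ?_, fun m h x ε hx hL hε => ?_, fun I γ hI hγ t₀ ht₀ => ?_⟩
  · obtain ⟨ℓ, y, hc, hy, he⟩ := RS.exists_sepPoint hb hab hx
    exact ⟨ℓ, y, hc, RS.abs_le_one_of_sq hy.1, RS.abs_le_one_of_sq hy.2.2.1, hy, he⟩
  · have hy := RS.isSepPoint_sepPointOf hb hab hx hL hε
    exact ⟨RS.sepPointOf a b ε x, rfl, rfl, RS.abs_le_one_of_sq hy.1,
      RS.abs_le_one_of_sq hy.2.2.1, RS.J_constRel hb hab hx hL hε, hy,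
      RS.expresses_sepPointOf hb hab hx hL hε,
      fun γ t hγt hγ => RS.hasDerivAt_sepU hb hab hx hL hε hγt hγ⟩
  · obtain ⟨δ, ℓ, m, h, y, hδ, hc, H⟩ := RS.exists_sepCurve hb hab hI hγ ht₀
    refine ⟨δ, ℓ, m, h, y, hδ, hc, fun t ht => ?_⟩
    obtain ⟨hJ, hy, he, hf⟩ := H t ht
    refine ⟨hJ, RS.abs_le_one_of_sq hy.1, RS.abs_le_one_of_sq hy.2.2.1, hy, he, hf.u₁, hf.u₂,
      hf.Q₁.continuousAt, hf.P₁.continuousAt, hf.Q₂.continuousAt, hf.P₂.continuousAt,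
      fun hL => ?_⟩
    have hu : (y t).u₁ ≠ 0 := fun h₀ => hL (by rw [he.lam_eq hb hab hc hy, h₀]; ring)
    -- The branch of √Λ is chosen by the sign of u₁ at time t, so it may change when the motion
    -- crosses Λ = 0.
    obtain ⟨ε, hε, hpos⟩ : ∃ ε : ℝ, (ε = 1 ∨ ε = -1) ∧ 0 < ε * (y t).u₁ := by
      rcases hu.lt_or_gt with h₁ | h₁
      · exact ⟨-1, .inr rfl, by linarith⟩
      · exact ⟨1, .inl rfl, by linarith⟩
    obtain ⟨h₁, h₂, h₃⟩ := he.sep_eq hb hab hc hy (RS.mul_abs_eq_of_mul_pos hε hpos) hu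
    exact ⟨ε, hε, h₁, h₂, h₃ hJ.2.1⟩
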